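/- **Setting.** Fix a set $\mathcal L$ of location names. *Local language.* A local language has types $t$ and expressions $e$, with type and expression variables and the usual capture-avoiding substitutions; a set of values; a small-step relation $e\to e'$ in which values do not step and which has the diamond property ($e_1\to e_2$ and $e_1\to e_3$ imply $e_2=e_3$ or $e_2\to e_4$, $e_3\to e_4$ for some $e_4$); and judgments $\Gamma\Vdash t$ (kinding, $\Gamma$ a set of type variables) and $\Gamma;\Sigma\Vdash e:t$ (typing, $\Sigma$ a partial map from variables to types). Required of them: $\alpha\in\Gamma$ implies $\Gamma\Vdash\alpha$; if $\Gamma;\Sigma\Vdash e:t$ then $\Gamma\Vdash t$ and $\Gamma\Vdash\Sigma$ (all types in $\Sigma$ are well-kinded in $\Gamma$); if $\Gamma\Vdash\Sigma$ and $x:t\in\Sigma$ then $\Gamma;\Sigma\Vdash x:t$; and kinding and typing are preserved by simultaneous well-kinded substitution of types and well-typed substitution of expressions (this includes weakening). There are closed well-kinded types $\mathsf{bool}$, $\mathsf{loc}_A$, $\mathsf{locset}_A$ (for finite $A\subseteq\mathcal L$) and $\mathsf{tyRep}$. A value represents at most one boolean, at most one location name, at most one finite set of location names, and at most one local type. Every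 closed value of these four types represents, respectively, a boolean, a name in $A$, a subset of $A$, a type; and if $\Gamma;\Sigma\Vdash v:\mathsf{tyRep}$ and the value $v$ represents $t$, then $\Gamma\Vdash t$. *Local progress*: if $\varnothing;\varnothing\Vdash e:t$ then $e$ is a value or $e\to e'$ for some $e'$. *Local preservation*: if $\Gamma;\Sigma\Vdash e:t$ and $e\to e'$ then $\Gamma;\Sigma\Vdash e':t$. *Local values are closed* if $\Gamma;\Sigma\Vdash v:t$ with $v$ a value implies $\Gamma;\varnothing\Vdash v:t$. *Types of $\lambda$QC.* Kinds are $*$ (choreographic types), $*_e$ (local types), $*_\ell$ (locations), $*_s$ (location sets). Locations are $\ell::=\alpha\mid L$ ($L\in\mathcal L$), location sets $\rho::=\alpha\mid\varnothing\mid\{\ell\}\mid\rho\cup\rho$ (syntactic terms), and choreographic types $\tau::=\alpha\mid t@\rho\mid\tau\to\tau\mid\tau\times\tau\mid\tau+\tau\mid\forall\alpha{::}\kappa.\tau\mid\mu\alpha.\tau$. The judgment $\Gamma\vdash\cdot::\kappa$ is the evident one, where variables have the kind given by $\Gamma$ and a local type is well-kinded if it is so in the local language over the variables of kind $*_e$ in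 $\Gamma$. A finite set of names is identified with the union of its singletons. *Necessary containment* $\ell\in\rho$ is generated by $\ell\in\{\ell\}$ and closure under unions. *Possible containment* $\lozenge(\ell\in\rho)$ is generated by $\lozenge(\ell\in\alpha)$, $\lozenge(\ell\in\{\alpha\})$, $\lozenge(L\in\{L\})$ and closure under unions. Two sets are *disjoint* if no $\ell$ is possibly in both. $\rho_1\subseteq\rho_2$ is generated by $\varnothing\subseteq\rho$, $\rho\subseteq\rho$, [$\rho\subseteq\rho_1$ or $\rho\subseteq\rho_2$] $\Rightarrow\rho\subseteq\rho_1\cup\rho_2$, $\ell\in\rho\Rightarrow\{\ell\}\subseteq\rho$, and $\rho_1,\rho_2\subseteq\rho\Rightarrow\rho_1\cup\rho_2\subseteq\rho$. *Choreographies.* $C::=X\mid\rho.e\mid\mathsf{fun}\,F(X{:}\tau):=C\mid C\,C\mid\Lambda\alpha{::}\kappa.C\mid C\,t\mid\mathsf{fold}\,C\mid\mathsf{unfold}\,C\mid(C,C)\mid\mathsf{fst}\,C\mid\mathsf{snd}\,C\mid\mathsf{inl}\,C\mid\mathsf{inr}\,C\mid\mathsf{case}\,C\,(X.C_1)(Y.C_2)\mid\mathsf{let}\,\rho.x{:}t:=C_1\,\mathsf{in}\,C_2\mid\mathsf{let}\,\rho.\alpha{::}\kappa:=C_1\,\mathsf{in}\,C_2\mid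 C\rightsquigarrow_\ell\rho\mid\ell[d]\rightsquigarrow\rho;C\mid\mathsf{if}_\rho\,C\,\mathsf{then}\,C_1\,\mathsf{else}\,C_2$, with $d\in\{\mathbf L,\mathbf R\}$; in $C\,t$, $t$ is a type, location or location set. Values are $\rho.v$ ($v$ a local value), $\mathsf{fun}$, $\Lambda$, and pairs, $\mathsf{inl}$, $\mathsf{inr}$, $\mathsf{fold}$ of values. *Typing* $\Gamma;\Delta;\Sigma\vdash C:\tau$. Here $\Gamma$ assigns kinds to type variables, $\Delta$ types of kind $*$ to choreographic variables, and $\Sigma$ consists of declarations $\rho.x{:}t$ of local variables; contexts are well-formed. $\Sigma|_\rho$ keeps the declarations $\rho'.x{:}t$ with $\rho\subseteq\rho'$. The rules for variables, recursive functions, type abstraction and application, products, sums and iso-recursive types are the standard ones. The others (with all displayed location sets, locations and result types well-kinded in $\Gamma$) are: - $\rho.e:t@\rho$ if $\Gamma;\Sigma|_\rho\Vdash e:t$. - $\mathsf{let}\,\rho.x{:}t:=C_1\,\mathsf{in}\,C_2:\tau$ if $C_1:t@\rho'$, $\rho\subseteq\rho'$, and $C_2:\tau$ under $\Sigma,\rho.x{:}t$.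 - $\mathsf{let}\,\rho.\alpha{::}\kappa:=C_1\,\mathsf{in}\,C_2:\tau$ if $\rho\subseteq\rho'$, $\Gamma\vdash\tau::*$ (so $\alpha$ is not free in $\tau$), $C_2:\tau$ under $\Gamma,\alpha{::}\kappa$, and either $\kappa=*_\ell$, $C_1:\mathsf{loc}_A@\rho'$, $A\subseteq\rho$; or $\kappa=*_s$, $C_1:\mathsf{locset}_A@\rho'$, $A\subseteq\rho$; or $\kappa=*_e$, $C_1:\mathsf{tyRep}@\rho'$. - $C\rightsquigarrow_\ell\rho_2:t@(\rho_1\cup\rho_2)$ if $C:t@\rho_1$ and $\ell\in\rho_1$. - $\ell[d]\rightsquigarrow\rho;C:\tau$ if $C:\tau$. - $\mathsf{if}_\rho\,C\,\mathsf{then}\,C_1\,\mathsf{else}\,C_2:\tau$ if $C:\mathsf{bool}@\rho'$, $\rho\subseteq\rho'$, and $C_1,C_2:\tau$. *Semantics.* Steps $C\Rightarrow_R C'$ are labelled by redices $R$, which record the kind of reduction, its participants and the data used. The set $\mathrm{rloc}(R)$ of locations blocked by $R$ consists of the participants for local, let, send, selection and if steps; it is all locations for application, unfolding, projection and case steps;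 and it is unchanged by wrapping a redex in the markers recording that it acts in a function, argument, left-pair or right-pair position. The set $\mathrm{cloc}(C)$ is $\rho$ for $\rho.e$; empty for variables, functions and $\Lambda$; all locations for applications, $\mathsf{unfold}$, projections and $\mathsf{case}$; and otherwise the union of the sets for the immediate subterms and the location sets (and sender) displayed by the construct. The rules are: - call-by-value, left-to-right reduction in evaluation contexts, with the standard $\beta$-rules for functions, type abstractions, sums, products and $\mathsf{unfold}(\mathsf{fold}\,V)$; - $\rho.e\Rightarrow\rho.e'$ if $e\to e'$; - for local values $v$: $\mathsf{let}\,\rho.x{:}t:=\rho'.v\,\mathsf{in}\,C\Rightarrow C[x\mapsto v]$; $\mathsf{let}\,\rho.\alpha{::}\kappa:=\rho'.v\,\mathsf{in}\,C\Rightarrow C[\alpha\mapsto t]$ if $v$ represents the local type, location or location set $t$, according to $\kappa$; $\rho_1.v\rightsquigarrow_\ell\rho_2\Rightarrow(\rho_1\cup\rho_2).v$; $\mathsf{if}_\rho\,\rho'.v\,\mathsf{then}\,C_1\,\mathsf{else}\,C_2$ steps to $C_1$ or $C_2$ as $v$ represents true or false; - $\ell[d]\rightsquigarrow\rho;C\Rightarrow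 C$; - out-of-order steps: $R$ may be performed in the body of either let form if $\mathrm{rloc}(R)$ is disjoint from $\rho$ and $\mathrm{cloc}(C_1)$; under a selection if it is disjoint from $\{\ell\}\cup\rho$; in both branches of an $\mathsf{if}_\rho\,C$ simultaneously, with the same $R$, if it is disjoint from $\rho$ and $\mathrm{cloc}(C)$; in $C_2$ of $C_1\,C_2$ or $(C_1,C_2)$ if it is disjoint from $\mathrm{cloc}(C_1)$. **Theorem (type soundness of $\lambda$QC).** Let the local language satisfy local progress and local preservation. 1. *Preservation.* If $\Gamma;\Delta;\Sigma\vdash C:\tau$ and $C\Rightarrow_R C'$ for some redex $R$, and if $\Sigma$ is empty or local values are closed, then $\Gamma;\Delta;\Sigma\vdash C':\tau$. 2. *Progress.* If $\varnothing;\varnothing;\varnothing\vdash C:\tau$, then $C$ is a value or there are $R$ and $C'$ with $C\Rightarrow_R C'$. -/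

import Mathlib

namespace LambdaQC

universe u v w

/-- A local language over a set `Loc` of location names: types and expressions with de Bruijn
variables and parallel substitution, values, a small-step semantics, a kinding and a typing
judgment, and the types whose values represent booleans, location names, finite sets of location
names, and local types.  There is one local kind, so a kinding context is the set of type variables
in scope; a typing context is a partial map from variables to types. -/
structure LocalLang (Loc : Type u) where
  /-- local types -/
  Ty : Type v
  /-- local expressions -/
  Expr : Type w
  /-- type variables -/
  tvar : ℕ → Ty
  /-- parallel substitution in a type -/
  tySubst : (ℕ → Ty) → Ty → Ty
  tySubst_tvar : ∀ σ n, tySubst σ (tvar n) = σ n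
  tySubst_id : ∀ t, tySubst tvar t = t
  tySubst_comp : ∀ σ θ t, tySubst θ (tySubst σ t) = tySubst (fun n => tySubst θ (σ n)) t
  /-- expression variables -/
  var : ℕ → Expr
  /-- parallel substitution of expressions in an expression -/
  subst : (ℕ → Expr) → Expr → Expr
  subst_var : ∀ σ n, subst σ (var n) = σ n
  subst_id : ∀ e, subst var e = e
  subst_comp : ∀ σ θ e, subst θ (subst σ e) = subst (fun n => subst θ (σ n)) e
  /-- parallel substitution of types in an expression -/
  instTy : (ℕ → Ty) → Expr → Expr
  instTy_var : ∀ σ n, instTy σ (var n) = var n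
  instTy_id : ∀ e, instTy tvar e = e
  instTy_comp : ∀ σ θ e, instTy θ (instTy σ e) = instTy (fun n => tySubst θ (σ n)) e
  instTy_subst : ∀ σ s e, instTy σ (subst s e) = subst (fun n => instTy σ (s n)) (instTy σ e)
  /-- values -/
  IsVal : Expr → Prop
  /-- small steps -/
  Step : Expr → Expr → Prop
  val_not_step : ∀ v e, IsVal v → ¬ Step v e
  diamond : ∀ e₁ e₂ e₃, Step e₁ e₂ → Step e₁ e₃ → e₂ = e₃ ∨ ∃ e₄, Step e₂ e₄ ∧ Step e₃ e₄
  /-- `Kinded Γ t`: the type `t` is well-formed in `Γ` -/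
  Kinded : Set ℕ → Ty → Prop
  /-- `Typed Γ S e t`: the expression `e` has type `t` in `Γ; S` -/
  Typed : Set ℕ → (ℕ → Option Ty) → Expr → Ty → Prop
  kinded_tvar : ∀ Γ α, α ∈ Γ → Kinded Γ (tvar α)
  kinded_subst : ∀ Γ Γ' σ t, Kinded Γ t → (∀ α ∈ Γ, Kinded Γ' (σ α)) → Kinded Γ' (tySubst σ t)
  typed_ctx : ∀ Γ S e t, Typed Γ S e t → ∀ x s, S x = some s → Kinded Γ s
  typed_kinded : ∀ Γ S e t, Typed Γ S e t → Kinded Γ t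
  typed_var : ∀ Γ S x t, (∀ y s, S y = some s → Kinded Γ s) → S x = some t → Typed Γ S (var x) t
  typed_subst : ∀ Γ S S' σ e t, Typed Γ S e t → (∀ y s, S' y = some s → Kinded Γ s) →
    (∀ x s, S x = some s → Typed Γ S' (σ x) s) → Typed Γ S' (subst σ e) t
  typed_instTy : ∀ Γ Γ' S σ e t, Typed Γ S e t → (∀ α ∈ Γ, Kinded Γ' (σ α)) →
    Typed Γ' (fun x => (S x).map (tySubst σ)) (instTy σ e) (tySubst σ t)
  /-- the type of booleans -/
  boolTy : Ty
  /-- the type of representations of location names in the given set -/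
  locTy : Finset Loc → Ty
  /-- the type of representations of subsets of the given set -/
  locSetTy : Finset Loc → Ty
  /-- the type of representations of local types -/
  repTy : Ty
  kinded_boolTy : ∀ Γ, Kinded Γ boolTy
  kinded_locTy : ∀ Γ A, Kinded Γ (locTy A)
  kinded_locSetTy : ∀ Γ A, Kinded Γ (locSetTy A)
  kinded_repTy : ∀ Γ, Kinded Γ repTy
  subst_boolTy : ∀ σ, tySubst σ boolTy = boolTy
  subst_locTy : ∀ σ A, tySubst σ (locTy A) = locTy A
  subst_locSetTy : ∀ σ A, tySubst σ (locSetTy A) = locSetTy A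
  subst_repTy : ∀ σ, tySubst σ repTy = repTy
  /-- the boolean, location, set of locations, or type that an expression represents, if any -/
  asBool : Expr → Option Bool
  asLoc : Expr → Option Loc
  asLocSet : Expr → Option (Finset Loc)
  asTy : Expr → Option Ty
  val_bool : ∀ v, IsVal v → Typed ∅ (fun _ => none) v boolTy → ∃ b, asBool v = some b
  val_loc : ∀ v A, IsVal v → Typed ∅ (fun _ => none) v (locTy A) → ∃ L ∈ A, asLoc v = some L
  val_locSet : ∀ v A, IsVal v → Typed ∅ (fun _ => none) v (locSetTy A) →
    ∃ B ⊆ A, asLocSet v = some B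
  val_rep : ∀ v, IsVal v → Typed ∅ (fun _ => none) v repTy → ∃ t, asTy v = some t
  rep_kinded : ∀ Γ S v t, IsVal v → Typed Γ S v repTy → asTy v = some t → Kinded Γ t

/-- Local progress. -/
def LocalLang.Progress {Loc : Type u} (𝕃 : LocalLang.{u, v, w} Loc) : Prop :=
  ∀ e t, 𝕃.Typed ∅ (fun _ => none) e t → 𝕃.IsVal e ∨ ∃ e', 𝕃.Step e e'

/-- Local preservation. -/
def LocalLang.Preservation {Loc : Type u} (𝕃 : LocalLang.{u, v, w} Loc) : Prop :=
  ∀ Γ S e e' t, 𝕃.Typed Γ S e t → 𝕃.Step e e' → 𝕃.Typed Γ S e' t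

/-- Local values contain no free expression variables (as far as typing can see). -/
def LocalLang.ValuesClosed {Loc : Type u} (𝕃 : LocalLang.{u, v, w} Loc) : Prop :=
  ∀ Γ S v t, 𝕃.IsVal v → 𝕃.Typed Γ S v t → 𝕃.Typed Γ (fun _ => none) v t

/-- Kinds: choreographic types, local types, locations, location sets. -/
inductive Kind : Type
  | chor
  | lty
  | loc
  | locSet

/-- Lifting a renaming under a binder. -/
def upRen (ξ : ℕ → ℕ) : ℕ → ℕ
  | 0 => 0
  | n + 1 => ξ n + 1

/-- Choreographic types, locations and location sets.  All type variables, of whatever kind, share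
one de Bruijn index space. -/
inductive CTy {Loc : Type u} (𝕃 : LocalLang.{u, v, w} Loc) : Type (max u v)
  /-- type variable `α` -/
  | var (n : ℕ)
  /-- local type -/
  | lty (t : 𝕃.Ty)
  /-- `t @ ρ`, for a local type `t` -/
  | located (t : 𝕃.Ty) (ρ : CTy 𝕃)
  | arr (τ₁ τ₂ : CTy 𝕃)
  /-- `∀ α :: κ. τ` -/
  | all (κ : Kind) (τ : CTy 𝕃)
  | prod (τ₁ τ₂ : CTy 𝕃)
  | sum (τ₁ τ₂ : CTy 𝕃)
  /-- `μ α. τ` -/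
  | mu (τ : CTy 𝕃)
  /-- location name -/
  | loc (L : Loc)
  /-- the empty location set -/
  | empty
  /-- `{ℓ}` -/
  | sng (l : CTy 𝕃)
  | union (ρ₁ ρ₂ : CTy 𝕃)

section Calculus

variable {Loc : Type u} {𝕃 : LocalLang.{u, v, w} Loc}

namespace CTy

def rename (ξ : ℕ → ℕ) : CTy 𝕃 → CTy 𝕃
  | var n => var (ξ n)
  | lty t => lty (𝕃.tySubst (fun n => 𝕃.tvar (ξ n)) t)
  | located t ρ => located (𝕃.tySubst (fun n => 𝕃.tvar (ξ n)) t) (ρ.rename ξ)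
  | arr τ₁ τ₂ => arr (τ₁.rename ξ) (τ₂.rename ξ)
  | all κ τ => all κ (τ.rename (upRen ξ))
  | prod τ₁ τ₂ => prod (τ₁.rename ξ) (τ₂.rename ξ)
  | sum τ₁ τ₂ => sum (τ₁.rename ξ) (τ₂.rename ξ)
  | mu τ => mu (τ.rename (upRen ξ))
  | loc L => loc L
  | empty => empty
  | sng l => sng (l.rename ξ)
  | union ρ₁ ρ₂ => union (ρ₁.rename ξ) (ρ₂.rename ξ)

/-- Weakening by one type variable. -/
def shift (τ : CTy 𝕃) : CTy 𝕃 := τ.rename Nat.succ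

/-- The local type denoted by a type of local kind, which is a variable or a local type.  The last
value is a default for types of other kinds; local types never mention variables of other kinds. -/
def toLocal : CTy 𝕃 → 𝕃.Ty
  | var n => 𝕃.tvar n
  | lty t => t
  | _ => 𝕃.boolTy

/-- Lifting a type substitution under a binder of a type variable. -/
def up (σ : ℕ → CTy 𝕃) : ℕ → CTy 𝕃
  | 0 => var 0
  | n + 1 => (σ n).shift

/-- Parallel substitution. -/
def subst (σ : ℕ → CTy 𝕃) : CTy 𝕃 → CTy 𝕃
  | var n => σ n
  | lty t => lty (𝕃.tySubst (fun n => (σ n).toLocal) t)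
  | located t ρ => located (𝕃.tySubst (fun n => (σ n).toLocal) t) (ρ.subst σ)
  | arr τ₁ τ₂ => arr (τ₁.subst σ) (τ₂.subst σ)
  | all κ τ => all κ (τ.subst (up σ))
  | prod τ₁ τ₂ => prod (τ₁.subst σ) (τ₂.subst σ)
  | sum τ₁ τ₂ => sum (τ₁.subst σ) (τ₂.subst σ)
  | mu τ => mu (τ.subst (up σ))
  | loc L => loc L
  | empty => empty
  | sng l => sng (l.subst σ)
  | union ρ₁ ρ₂ => union (ρ₁.subst σ) (ρ₂.subst σ)

/-- The substitution of `t` for variable `0`. -/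
def one (t : CTy 𝕃) : ℕ → CTy 𝕃
  | 0 => t
  | n + 1 => var n

/-- A finite set of location names as a location set. -/
noncomputable def ofFinset (A : Finset Loc) : CTy 𝕃 :=
  A.toList.foldr (fun L ρ => union (sng (loc L)) ρ) empty

end CTy

/-- Necessary containment `□ (ℓ ∈ ρ)`, also written `ℓ ∈ ρ`. -/
inductive Nec : CTy 𝕃 → CTy 𝕃 → Prop
  | sng (l) : Nec l (.sng l)
  | left {l ρ₁ ρ₂} : Nec l ρ₁ → Nec l (.union ρ₁ ρ₂)
  | right {l ρ₁ ρ₂} : Nec l ρ₂ → Nec l (.union ρ₁ ρ₂)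

/-- Possible containment `◇ (ℓ ∈ ρ)`. -/
inductive Poss : CTy 𝕃 → CTy 𝕃 → Prop
  | var (l n) : Poss l (.var n)
  | sngVar (l n) : Poss l (.sng (.var n))
  | sngLoc (L) : Poss (.loc L) (.sng (.loc L))
  | left {l ρ₁ ρ₂} : Poss l ρ₁ → Poss l (.union ρ₁ ρ₂)
  | right {l ρ₁ ρ₂} : Poss l ρ₂ → Poss l (.union ρ₁ ρ₂)

/-- The locations possibly in `ρ`.  This is everything as soon as `ρ` mentions a variable, and
consists of location names otherwise, so it does not depend on the scope of `ρ`. -/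
def poss (ρ : CTy 𝕃) : Set (CTy 𝕃) := {l | Poss l ρ}

/-- The (necessary) subset relation `ρ₁ ⊆ ρ₂` of location sets. -/
inductive SubLoc : CTy 𝕃 → CTy 𝕃 → Prop
  | empty (ρ) : SubLoc .empty ρ
  | refl (ρ) : SubLoc ρ ρ
  | left {ρ ρ₁ ρ₂} : SubLoc ρ ρ₁ → SubLoc ρ (.union ρ₁ ρ₂)
  | right {ρ ρ₁ ρ₂} : SubLoc ρ ρ₂ → SubLoc ρ (.union ρ₁ ρ₂)
  | sng {l ρ} : Nec l ρ → SubLoc (.sng l) ρ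
  | union {ρ₁ ρ₂ ρ} : SubLoc ρ₁ ρ → SubLoc ρ₂ ρ → SubLoc (.union ρ₁ ρ₂) ρ

/-- The variables of local kind in a kinding context. -/
def localKinds (Γ : List Kind) : Set ℕ := {n | Γ[n]? = some Kind.lty}

/-- The kinding judgment `Γ ⊢ t :: κ`. -/
inductive Kinded : List Kind → CTy 𝕃 → Kind → Prop
  | var {Γ n κ} : Γ[n]? = some κ → Kinded Γ (.var n) κ
  | lty {Γ t} : 𝕃.Kinded (localKinds Γ) t → Kinded Γ (.lty t) .lty
  | located {Γ t ρ} : Kinded Γ (.lty t) .lty → Kinded Γ ρ .locSet →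
      Kinded Γ (.located t ρ) .chor
  | arr {Γ τ₁ τ₂} : Kinded Γ τ₁ .chor → Kinded Γ τ₂ .chor → Kinded Γ (.arr τ₁ τ₂) .chor
  | all {Γ κ τ} : Kinded (κ :: Γ) τ .chor → Kinded Γ (.all κ τ) .chor
  | prod {Γ τ₁ τ₂} : Kinded Γ τ₁ .chor → Kinded Γ τ₂ .chor → Kinded Γ (.prod τ₁ τ₂) .chor
  | sum {Γ τ₁ τ₂} : Kinded Γ τ₁ .chor → Kinded Γ τ₂ .chor → Kinded Γ (.sum τ₁ τ₂) .chor
  | mu {Γ τ} : Kinded (.chor :: Γ) τ .chor → Kinded Γ (.mu τ) .chor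
  | loc {Γ} (L) : Kinded Γ (.loc L) .loc
  | empty {Γ} : Kinded Γ .empty .locSet
  | sng {Γ l} : Kinded Γ l .loc → Kinded Γ (.sng l) .locSet
  | union {Γ ρ₁ ρ₂} : Kinded Γ ρ₁ .locSet → Kinded Γ ρ₂ .locSet → Kinded Γ (.union ρ₁ ρ₂) .locSet

/-- Selection labels. -/
inductive Choice : Type
  | left
  | right

/-- Choreographies.  Choreographic variables, local variables and type variables have one de Bruijn
index space each; the local variables of all locations share one. -/
inductive Chor (𝕃 : LocalLang.{u, v, w} Loc) : Type (max u v w)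
  /-- choreographic variable `X` -/
  | var (n : ℕ)
  /-- local computation `ρ.e` -/
  | comp (ρ : CTy 𝕃) (e : 𝕃.Expr)
  /-- recursive function `fun F(X : τ) := C`; in `C`, index `0` is `X` and index `1` is `F` -/
  | fn (τ : CTy 𝕃) (C : Chor 𝕃)
  | app (C₁ C₂ : Chor 𝕃)
  /-- `Λ α :: κ. C` -/
  | tabs (κ : Kind) (C : Chor 𝕃)
  | tapp (C : Chor 𝕃) (t : CTy 𝕃)
  | fold (C : Chor 𝕃)
  | unfold (C : Chor 𝕃)
  | pair (C₁ C₂ : Chor 𝕃)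
  | fst (C : Chor 𝕃)
  | snd (C : Chor 𝕃)
  | inl (C : Chor 𝕃)
  | inr (C : Chor 𝕃)
  /-- `case C of inl X => C₁ | inr Y => C₂` -/
  | caseOf (C C₁ C₂ : Chor 𝕃)
  /-- `let ρ.x : t := C₁ in C₂`, binding a local variable in `C₂` -/
  | letE (ρ : CTy 𝕃) (t : 𝕃.Ty) (C₁ C₂ : Chor 𝕃)
  /-- `let ρ.α :: κ := C₁ in C₂`, binding a type variable in `C₂` -/
  | letT (ρ : CTy 𝕃) (κ : Kind) (C₁ C₂ : Chor 𝕃)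
  /-- `ℓ` sends the result of `C` to `ρ` -/
  | send (C : Chor 𝕃) (l ρ : CTy 𝕃)
  /-- `ℓ` sends the selection `d` to `ρ`, then `C` -/
  | sync (l : CTy 𝕃) (d : Choice) (ρ : CTy 𝕃) (C : Chor 𝕃)
  /-- `if_ρ C then C₁ else C₂` -/
  | ite (ρ : CTy 𝕃) (C C₁ C₂ : Chor 𝕃)

/-- Weakening a local expression by one type variable. -/
def shiftTyE (e : 𝕃.Expr) : 𝕃.Expr := 𝕃.instTy (fun n => 𝕃.tvar (n + 1)) e

/-- Lifting a substitution of local expressions under a binder of a local variable. -/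
def upE (σ : ℕ → 𝕃.Expr) : ℕ → 𝕃.Expr
  | 0 => 𝕃.var 0
  | n + 1 => 𝕃.subst (fun m => 𝕃.var (m + 1)) (σ n)

/-- The substitution of `e` for local variable `0`. -/
def oneE (e : 𝕃.Expr) : ℕ → 𝕃.Expr
  | 0 => e
  | n + 1 => 𝕃.var n

namespace Chor

/-- Substitution of types. -/
def tsubst (σ : ℕ → CTy 𝕃) : Chor 𝕃 → Chor 𝕃
  | var n => var n
  | comp ρ e => comp (ρ.subst σ) (𝕃.instTy (fun n => (σ n).toLocal) e)
  | fn τ C => fn (τ.subst σ) (C.tsubst σ)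
  | app C₁ C₂ => app (C₁.tsubst σ) (C₂.tsubst σ)
  | tabs κ C => tabs κ (C.tsubst (CTy.up σ))
  | tapp C t => tapp (C.tsubst σ) (t.subst σ)
  | fold C => fold (C.tsubst σ)
  | unfold C => unfold (C.tsubst σ)
  | pair C₁ C₂ => pair (C₁.tsubst σ) (C₂.tsubst σ)
  | fst C => fst (C.tsubst σ)
  | snd C => snd (C.tsubst σ)
  | inl C => inl (C.tsubst σ)
  | inr C => inr (C.tsubst σ)
  | caseOf C C₁ C₂ => caseOf (C.tsubst σ) (C₁.tsubst σ) (C₂.tsubst σ)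
  | letE ρ t C₁ C₂ =>
      letE (ρ.subst σ) (𝕃.tySubst (fun n => (σ n).toLocal) t) (C₁.tsubst σ) (C₂.tsubst σ)
  | letT ρ κ C₁ C₂ => letT (ρ.subst σ) κ (C₁.tsubst σ) (C₂.tsubst (CTy.up σ))
  | send C l ρ => send (C.tsubst σ) (l.subst σ) (ρ.subst σ)
  | sync l d ρ C => sync (l.subst σ) d (ρ.subst σ) (C.tsubst σ)
  | ite ρ C C₁ C₂ => ite (ρ.subst σ) (C.tsubst σ) (C₁.tsubst σ) (C₂.tsubst σ)

/-- Substitution of local expressions for local variables. -/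
def esubst (σ : ℕ → 𝕃.Expr) : Chor 𝕃 → Chor 𝕃
  | var n => var n
  | comp ρ e => comp ρ (𝕃.subst σ e)
  | fn τ C => fn τ (C.esubst σ)
  | app C₁ C₂ => app (C₁.esubst σ) (C₂.esubst σ)
  | tabs κ C => tabs κ (C.esubst (fun n => shiftTyE (σ n)))
  | tapp C t => tapp (C.esubst σ) t
  | fold C => fold (C.esubst σ)
  | unfold C => unfold (C.esubst σ)
  | pair C₁ C₂ => pair (C₁.esubst σ) (C₂.esubst σ)
  | fst C => fst (C.esubst σ)
  | snd C => snd (C.esubst σ)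
  | inl C => inl (C.esubst σ)
  | inr C => inr (C.esubst σ)
  | caseOf C C₁ C₂ => caseOf (C.esubst σ) (C₁.esubst σ) (C₂.esubst σ)
  | letE ρ t C₁ C₂ => letE ρ t (C₁.esubst σ) (C₂.esubst (upE σ))
  | letT ρ κ C₁ C₂ => letT ρ κ (C₁.esubst σ) (C₂.esubst (fun n => shiftTyE (σ n)))
  | send C l ρ => send (C.esubst σ) l ρ
  | sync l d ρ C => sync l d ρ (C.esubst σ)
  | ite ρ C C₁ C₂ => ite ρ (C.esubst σ) (C₁.esubst σ) (C₂.esubst σ)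

/-- Renaming of choreographic variables. -/
def rename (ξ : ℕ → ℕ) : Chor 𝕃 → Chor 𝕃
  | var n => var (ξ n)
  | comp ρ e => comp ρ e
  | fn τ C => fn τ (C.rename (upRen (upRen ξ)))
  | app C₁ C₂ => app (C₁.rename ξ) (C₂.rename ξ)
  | tabs κ C => tabs κ (C.rename ξ)
  | tapp C t => tapp (C.rename ξ) t
  | fold C => fold (C.rename ξ)
  | unfold C => unfold (C.rename ξ)
  | pair C₁ C₂ => pair (C₁.rename ξ) (C₂.rename ξ)
  | fst C => fst (C.rename ξ)
  | snd C => snd (C.rename ξ)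
  | inl C => inl (C.rename ξ)
  | inr C => inr (C.rename ξ)
  | caseOf C C₁ C₂ => caseOf (C.rename ξ) (C₁.rename (upRen ξ)) (C₂.rename (upRen ξ))
  | letE ρ t C₁ C₂ => letE ρ t (C₁.rename ξ) (C₂.rename ξ)
  | letT ρ κ C₁ C₂ => letT ρ κ (C₁.rename ξ) (C₂.rename ξ)
  | send C l ρ => send (C.rename ξ) l ρ
  | sync l d ρ C => sync l d ρ (C.rename ξ)
  | ite ρ C C₁ C₂ => ite ρ (C.rename ξ) (C₁.rename ξ) (C₂.rename ξ)

/-- Lifting a substitution of choreographies under a binder of a choreographic variable. -/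
def up (σ : ℕ → Chor 𝕃) : ℕ → Chor 𝕃
  | 0 => var 0
  | n + 1 => (σ n).rename Nat.succ

/-- Weakening by one type variable. -/
def shiftT (C : Chor 𝕃) : Chor 𝕃 := C.tsubst (fun n => .var (n + 1))

/-- Weakening by one local variable. -/
def shiftE (C : Chor 𝕃) : Chor 𝕃 := C.esubst (fun n => 𝕃.var (n + 1))

/-- Substitution of choreographies for choreographic variables. -/
def subst (σ : ℕ → Chor 𝕃) : Chor 𝕃 → Chor 𝕃
  | var n => σ n
  | comp ρ e => comp ρ e
  | fn τ C => fn τ (C.subst (up (up σ)))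
  | app C₁ C₂ => app (C₁.subst σ) (C₂.subst σ)
  | tabs κ C => tabs κ (C.subst (fun n => (σ n).shiftT))
  | tapp C t => tapp (C.subst σ) t
  | fold C => fold (C.subst σ)
  | unfold C => unfold (C.subst σ)
  | pair C₁ C₂ => pair (C₁.subst σ) (C₂.subst σ)
  | fst C => fst (C.subst σ)
  | snd C => snd (C.subst σ)
  | inl C => inl (C.subst σ)
  | inr C => inr (C.subst σ)
  | caseOf C C₁ C₂ => caseOf (C.subst σ) (C₁.subst (up σ)) (C₂.subst (up σ))
  | letE ρ t C₁ C₂ => letE ρ t (C₁.subst σ) (C₂.subst (fun n => (σ n).shiftE))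
  | letT ρ κ C₁ C₂ => letT ρ κ (C₁.subst σ) (C₂.subst (fun n => (σ n).shiftT))
  | send C l ρ => send (C.subst σ) l ρ
  | sync l d ρ C => sync l d ρ (C.subst σ)
  | ite ρ C C₁ C₂ => ite ρ (C.subst σ) (C₁.subst σ) (C₂.subst σ)

/-- The substitution of `C` for choreographic variable `0`. -/
def one (C : Chor 𝕃) : ℕ → Chor 𝕃
  | 0 => C
  | n + 1 => var n

/-- The substitution of `C₀` for variable `0` and of `C₁` for variable `1`. -/
def two (C₀ C₁ : Chor 𝕃) : ℕ → Chor 𝕃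
  | 0 => C₀
  | 1 => C₁
  | n + 2 => var n

/-- Choreographic values. -/
inductive IsVal : Chor 𝕃 → Prop
  | comp {ρ v} : 𝕃.IsVal v → IsVal (comp ρ v)
  | fn {τ C} : IsVal (fn τ C)
  | tabs {κ C} : IsVal (tabs κ C)
  | pair {V₁ V₂} : IsVal V₁ → IsVal V₂ → IsVal (pair V₁ V₂)
  | inl {V} : IsVal V → IsVal (inl V)
  | inr {V} : IsVal V → IsVal (inr V)
  | fold {V} : IsVal V → IsVal (fold V)

end Chor

/-- Local contexts of choreographies: each local variable has a location set, where it is bound, and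
a local type. -/
abbrev LCtx (𝕃 : LocalLang.{u, v, w} Loc) := List (CTy 𝕃 × 𝕃.Ty)

/-- Weakening a local context by one type variable. -/
def LCtx.shift (S : LCtx 𝕃) : LCtx 𝕃 :=
  S.map fun p => (p.1.shift, 𝕃.tySubst (fun n => 𝕃.tvar (n + 1)) p.2)

open Classical in
/-- The variables of `S` that all locations in `ρ` can use. -/
noncomputable def LCtx.proj (S : LCtx 𝕃) (ρ : CTy 𝕃) : ℕ → Option 𝕃.Ty := fun x =>
  match S[x]? with
  | some (ρ', t) => if SubLoc ρ ρ' then some t else none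
  | none => none

/-- Well-formed contexts. -/
inductive WF : List Kind → List (CTy 𝕃) → LCtx 𝕃 → Prop
  | nil {Γ} : WF Γ [] []
  | add {Γ Δ S τ} : WF Γ Δ S → Kinded Γ τ .chor → WF Γ (τ :: Δ) S
  | addLocal {Γ Δ S ρ t} : WF Γ Δ S → Kinded Γ ρ .locSet → Kinded Γ (.lty t : CTy 𝕃) .lty →
      WF Γ Δ ((ρ, t) :: S)

/-- The typing judgment `Γ; Δ; S ⊢ C : τ`. -/
inductive Typed : List Kind → List (CTy 𝕃) → LCtx 𝕃 → Chor 𝕃 → CTy 𝕃 → Prop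
  | var {Γ Δ S n τ} : WF Γ Δ S → Δ[n]? = some τ → Typed Γ Δ S (.var n) τ
  | comp {Γ Δ S ρ e t} : WF Γ Δ S → Kinded Γ ρ .locSet →
      𝕃.Typed (localKinds Γ) (S.proj ρ) e t → Typed Γ Δ S (.comp ρ e) (.located t ρ)
  | fn {Γ Δ S τ₁ τ₂ C} : Typed Γ (τ₁ :: .arr τ₁ τ₂ :: Δ) S C τ₂ →
      Typed Γ Δ S (.fn τ₁ C) (.arr τ₁ τ₂)
  | app {Γ Δ S C₁ C₂ τ₁ τ₂} : Typed Γ Δ S C₁ (.arr τ₁ τ₂) → Typed Γ Δ S C₂ τ₁ →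
      Typed Γ Δ S (.app C₁ C₂) τ₂
  | tabs {Γ Δ S κ C τ} : Typed (κ :: Γ) (Δ.map CTy.shift) S.shift C τ →
      Typed Γ Δ S (.tabs κ C) (.all κ τ)
  | tapp {Γ Δ S κ C τ t} : Typed Γ Δ S C (.all κ τ) → Kinded Γ t κ →
      Typed Γ Δ S (.tapp C t) (τ.subst (CTy.one t))
  | fold {Γ Δ S C τ} : Kinded Γ (.mu τ) .chor → Typed Γ Δ S C (τ.subst (CTy.one (.mu τ))) →
      Typed Γ Δ S (.fold C) (.mu τ)
  | unfold {Γ Δ S C τ} : Typed Γ Δ S C (.mu τ) →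
      Typed Γ Δ S (.unfold C) (τ.subst (CTy.one (.mu τ)))
  | pair {Γ Δ S C₁ C₂ τ₁ τ₂} : Typed Γ Δ S C₁ τ₁ → Typed Γ Δ S C₂ τ₂ →
      Typed Γ Δ S (.pair C₁ C₂) (.prod τ₁ τ₂)
  | fst {Γ Δ S C τ₁ τ₂} : Typed Γ Δ S C (.prod τ₁ τ₂) → Typed Γ Δ S (.fst C) τ₁
  | snd {Γ Δ S C τ₁ τ₂} : Typed Γ Δ S C (.prod τ₁ τ₂) → Typed Γ Δ S (.snd C) τ₂
  | inl {Γ Δ S C τ₁ τ₂} : Typed Γ Δ S C τ₁ → Kinded Γ τ₂ .chor →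
      Typed Γ Δ S (.inl C) (.sum τ₁ τ₂)
  | inr {Γ Δ S C τ₁ τ₂} : Typed Γ Δ S C τ₂ → Kinded Γ τ₁ .chor →
      Typed Γ Δ S (.inr C) (.sum τ₁ τ₂)
  | caseOf {Γ Δ S C C₁ C₂ τ₁ τ₂ τ} : Typed Γ Δ S C (.sum τ₁ τ₂) →
      Typed Γ (τ₁ :: Δ) S C₁ τ → Typed Γ (τ₂ :: Δ) S C₂ τ → Typed Γ Δ S (.caseOf C C₁ C₂) τ
  | letE {Γ Δ S ρ ρ' t C₁ C₂ τ} : Typed Γ Δ S C₁ (.located t ρ') → SubLoc ρ ρ' →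
      Typed Γ Δ ((ρ, t) :: S) C₂ τ → Typed Γ Δ S (.letE ρ t C₁ C₂) τ
  | letLoc {Γ Δ S A ρ ρ' C₁ C₂ τ} : Typed Γ Δ S C₁ (.located (𝕃.locTy A) ρ') → SubLoc ρ ρ' →
      SubLoc (.ofFinset A) ρ → Kinded Γ τ .chor →
      Typed (.loc :: Γ) (Δ.map CTy.shift) S.shift C₂ τ.shift →
      Typed Γ Δ S (.letT ρ .loc C₁ C₂) τ
  | letLocSet {Γ Δ S A ρ ρ' C₁ C₂ τ} : Typed Γ Δ S C₁ (.located (𝕃.locSetTy A) ρ') →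
      SubLoc ρ ρ' → SubLoc (.ofFinset A) ρ → Kinded Γ τ .chor →
      Typed (.locSet :: Γ) (Δ.map CTy.shift) S.shift C₂ τ.shift →
      Typed Γ Δ S (.letT ρ .locSet C₁ C₂) τ
  | letLocalTy {Γ Δ S ρ ρ' C₁ C₂ τ} : Typed Γ Δ S C₁ (.located 𝕃.repTy ρ') → SubLoc ρ ρ' →
      Kinded Γ τ .chor → Typed (.lty :: Γ) (Δ.map CTy.shift) S.shift C₂ τ.shift →
      Typed Γ Δ S (.letT ρ .lty C₁ C₂) τ
  | send {Γ Δ S C t l ρ₁ ρ₂} : Typed Γ Δ S C (.located t ρ₁) → Nec l ρ₁ → Kinded Γ ρ₂ .locSet →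
      Typed Γ Δ S (.send C l ρ₂) (.located t (.union ρ₁ ρ₂))
  | sync {Γ Δ S C l d ρ τ} : Kinded Γ l .loc → Kinded Γ ρ .locSet → Typed Γ Δ S C τ →
      Typed Γ Δ S (.sync l d ρ C) τ
  | ite {Γ Δ S C C₁ C₂ ρ ρ' τ} : Typed Γ Δ S C (.located 𝕃.boolTy ρ') → SubLoc ρ ρ' →
      Typed Γ Δ S C₁ τ → Typed Γ Δ S C₂ τ → Typed Γ Δ S (.ite ρ C C₁ C₂) τ

/-- Messages: local values and selections. -/
inductive Msg (𝕃 : LocalLang.{u, v, w} Loc) : Type w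
  | val (v : 𝕃.Expr)
  | sel (d : Choice)

/-- Redices, the labels of choreographic steps. -/
inductive Redex (𝕃 : LocalLang.{u, v, w} Loc) : Type (max u v w)
  | comp (ρ : CTy 𝕃) (e₁ e₂ : 𝕃.Expr)
  | fn (R : Redex 𝕃)
  | arg (R : Redex 𝕃)
  | app
  | tapp
  | unfoldFold
  | pairL (R : Redex 𝕃)
  | pairR (R : Redex 𝕃)
  | fstPair
  | sndPair
  | caseInl
  | caseInr
  | letE (ρ : CTy 𝕃) (v : 𝕃.Expr)
  | letT (ρ t : CTy 𝕃)
  | send (l : CTy 𝕃) (m : Msg 𝕃) (ρ : CTy 𝕃)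
  | ifTrue (ρ : CTy 𝕃)
  | ifFalse (ρ : CTy 𝕃)

/-- The action of maps on types and on local expressions on messages and redices. -/
def Msg.map (g : 𝕃.Expr → 𝕃.Expr) : Msg 𝕃 → Msg 𝕃
  | val v => val (g v)
  | sel d => sel d

def Redex.map (f : CTy 𝕃 → CTy 𝕃) (g : 𝕃.Expr → 𝕃.Expr) : Redex 𝕃 → Redex 𝕃
  | comp ρ e₁ e₂ => comp (f ρ) (g e₁) (g e₂)
  | fn R => fn (R.map f g)
  | arg R => arg (R.map f g)
  | app => app
  | tapp => tapp
  | unfoldFold => unfoldFold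
  | pairL R => pairL (R.map f g)
  | pairR R => pairR (R.map f g)
  | fstPair => fstPair
  | sndPair => sndPair
  | caseInl => caseInl
  | caseInr => caseInr
  | letE ρ v => letE (f ρ) (g v)
  | letT ρ t => letT (f ρ) (f t)
  | send l m ρ => send (f l) (m.map g) (f ρ)
  | ifTrue ρ => ifTrue (f ρ)
  | ifFalse ρ => ifFalse (f ρ)

/-- Leaving the scope of variable `0`, which is renamed to `k`. -/
def exitScope (k : ℕ) : ℕ → ℕ
  | 0 => k
  | n + 1 => n

/-- A redex seen from outside a binder of a local variable.  If the bound variable occurs in the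
redex it is shown under the name `k`; if it does not, then `k` does not matter. -/
def Redex.exitE (k : ℕ) (R : Redex 𝕃) : Redex 𝕃 :=
  R.map id (𝕃.subst fun n => 𝕃.var (exitScope k n))

/-- A redex seen from outside a binder of a type variable, shown under the name `k`. -/
def Redex.exitT (k : ℕ) (R : Redex 𝕃) : Redex 𝕃 :=
  R.map (CTy.rename (exitScope k)) (𝕃.instTy fun n => 𝕃.tvar (exitScope k n))

/-- The locations (possibly) blocked by a redex; `Set.univ` is the set of all locations. -/
def Redex.rloc : Redex 𝕃 → Set (CTy 𝕃)
  | comp ρ _ _ => poss ρ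
  | fn R => R.rloc
  | arg R => R.rloc
  | app => Set.univ
  | tapp => Set.univ
  | unfoldFold => Set.univ
  | pairL R => R.rloc
  | pairR R => R.rloc
  | fstPair => Set.univ
  | sndPair => Set.univ
  | caseInl => Set.univ
  | caseInr => Set.univ
  | letE ρ _ => poss ρ
  | letT ρ _ => poss ρ
  | send l _ ρ => poss (.sng l) ∪ poss ρ
  | ifTrue ρ => poss ρ
  | ifFalse ρ => poss ρ

/-- The locations (possibly) blocked by a choreography. -/
def Chor.cloc : Chor 𝕃 → Set (CTy 𝕃)
  | var _ => ∅
  | comp ρ _ => poss ρ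
  | fn _ _ => ∅
  | app _ _ => Set.univ
  | tabs _ _ => ∅
  | tapp _ _ => Set.univ
  | fold C => C.cloc
  | unfold _ => Set.univ
  | pair C₁ C₂ => C₁.cloc ∪ C₂.cloc
  | fst _ => Set.univ
  | snd _ => Set.univ
  | inl C => C.cloc
  | inr C => C.cloc
  | caseOf _ _ _ => Set.univ
  | letE ρ _ C₁ C₂ => poss ρ ∪ C₁.cloc ∪ C₂.cloc
  | letT ρ _ C₁ C₂ => poss ρ ∪ C₁.cloc ∪ C₂.cloc
  | send C l ρ => poss (.sng l) ∪ poss ρ ∪ C.cloc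
  | sync l _ ρ C => poss (.sng l) ∪ poss ρ ∪ C.cloc
  | ite ρ C C₁ C₂ => poss ρ ∪ C.cloc ∪ C₁.cloc ∪ C₂.cloc

/-- Evaluation contexts (one layer). -/
inductive EvalCtx (𝕃 : LocalLang.{u, v, w} Loc) : Type (max u v w)
  | appL (C : Chor 𝕃)
  | appR (V : Chor 𝕃) (hV : V.IsVal)
  | tapp (t : CTy 𝕃)
  | fold
  | unfold
  | pairL (C : Chor 𝕃)
  | pairR (V : Chor 𝕃) (hV : V.IsVal)
  | fst
  | snd
  | inl
  | inr
  | caseOf (C₁ C₂ : Chor 𝕃)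
  | letE (ρ : CTy 𝕃) (t : 𝕃.Ty) (C₂ : Chor 𝕃)
  | letT (ρ : CTy 𝕃) (κ : Kind) (C₂ : Chor 𝕃)
  | send (l ρ : CTy 𝕃)
  | ite (ρ : CTy 𝕃) (C₁ C₂ : Chor 𝕃)

/-- Filling the hole. -/
def EvalCtx.fill : EvalCtx 𝕃 → Chor 𝕃 → Chor 𝕃
  | appL C₂, C => .app C C₂
  | appR V _, C => .app V C
  | tapp t, C => .tapp C t
  | fold, C => .fold C
  | unfold, C => .unfold C
  | pairL C₂, C => .pair C C₂
  | pairR V _, C => .pair V C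
  | fst, C => .fst C
  | snd, C => .snd C
  | inl, C => .inl C
  | inr, C => .inr C
  | caseOf C₁ C₂, C => .caseOf C C₁ C₂
  | letE ρ t C₂, C => .letE ρ t C C₂
  | letT ρ κ C₂, C => .letT ρ κ C C₂
  | send l ρ, C => .send C l ρ
  | ite ρ C₁ C₂, C => .ite ρ C C₁ C₂

/-- The redex that performs a given redex in an evaluation context. -/
def EvalCtx.redex : EvalCtx 𝕃 → Redex 𝕃 → Redex 𝕃
  | appL _, R => .fn R
  | appR _ _, R => .arg R
  | pairL _, R => .pairL R
  | pairR _ _, R => .pairR R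
  | _, R => R

/-- The type, location or location set that a local value represents. -/
noncomputable def resolve (𝕃 : LocalLang.{u, v, w} Loc) : Kind → 𝕃.Expr → Option (CTy 𝕃)
  | .chor, _ => none
  | .lty, v => (𝕃.asTy v).map CTy.lty
  | .loc, v => (𝕃.asLoc v).map CTy.loc
  | .locSet, v => (𝕃.asLocSet v).map CTy.ofFinset

/-- The operational semantics of choreographies: `Step C R C'` is the step from `C` to `C'` labelled
with the redex `R`.  The rules whose name ends in `I` are the out-of-order steps. -/
inductive Step : Chor 𝕃 → Redex 𝕃 → Chor 𝕃 → Prop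
  | ctx {C R C'} (η : EvalCtx 𝕃) : Step C R C' → Step (η.fill C) (η.redex R) (η.fill C')
  | comp {ρ e₁ e₂} : 𝕃.Step e₁ e₂ → Step (.comp ρ e₁) (.comp ρ e₁ e₂) (.comp ρ e₂)
  | app {τ C V} : V.IsVal → Step (.app (.fn τ C) V) .app (C.subst (Chor.two V (.fn τ C)))
  | tapp {κ C t} : Step (.tapp (.tabs κ C) t) .tapp (C.tsubst (CTy.one t))
  | unfoldFold {V} : V.IsVal → Step (.unfold (.fold V)) .unfoldFold V
  | fstPair {V₁ V₂} : V₁.IsVal → V₂.IsVal → Step (.fst (.pair V₁ V₂)) .fstPair V₁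
  | sndPair {V₁ V₂} : V₁.IsVal → V₂.IsVal → Step (.snd (.pair V₁ V₂)) .sndPair V₂
  | caseInl {V C₁ C₂} : V.IsVal →
      Step (.caseOf (.inl V) C₁ C₂) .caseInl (C₁.subst (Chor.one V))
  | caseInr {V C₁ C₂} : V.IsVal →
      Step (.caseOf (.inr V) C₁ C₂) .caseInr (C₂.subst (Chor.one V))
  | letEV {ρ ρ' t v C₂} : 𝕃.IsVal v →
      Step (.letE ρ t (.comp ρ' v) C₂) (.letE ρ v) (C₂.esubst (oneE v))
  | letEI {ρ t C₁ C₂ C₂' R} (k : ℕ) : Step C₂ R C₂' →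
      Disjoint (R.exitE k).rloc (poss ρ ∪ C₁.cloc) →
      Step (.letE ρ t C₁ C₂) (R.exitE k) (.letE ρ t C₁ C₂')
  | letTV {ρ ρ' κ v t C₂} : 𝕃.IsVal v → resolve 𝕃 κ v = some t →
      Step (.letT ρ κ (.comp ρ' v) C₂) (.letT ρ t) (C₂.tsubst (CTy.one t))
  | letTI {ρ κ C₁ C₂ C₂' R} (k : ℕ) : Step C₂ R C₂' →
      Disjoint (R.exitT k).rloc (poss ρ ∪ C₁.cloc) →
      Step (.letT ρ κ C₁ C₂) (R.exitT k) (.letT ρ κ C₁ C₂')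
  | sendV {ρ₁ v l ρ₂} : 𝕃.IsVal v →
      Step (.send (.comp ρ₁ v) l ρ₂) (.send l (.val v) ρ₂) (.comp (.union ρ₁ ρ₂) v)
  | sync {l d ρ C} : Step (.sync l d ρ C) (.send l (.sel d) ρ) C
  | syncI {l d ρ C C' R} : Step C R C' → Disjoint R.rloc (poss (.sng l) ∪ poss ρ) →
      Step (.sync l d ρ C) R (.sync l d ρ C')
  | ifT {ρ ρ' v C₁ C₂} : 𝕃.IsVal v → 𝕃.asBool v = some true →
      Step (.ite ρ (.comp ρ' v) C₁ C₂) (.ifTrue ρ) C₁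
  | ifF {ρ ρ' v C₁ C₂} : 𝕃.IsVal v → 𝕃.asBool v = some false →
      Step (.ite ρ (.comp ρ' v) C₁ C₂) (.ifFalse ρ) C₂
  | ifI {ρ C C₁ C₁' C₂ C₂' R} : Step C₁ R C₁' → Step C₂ R C₂' →
      Disjoint R.rloc (poss ρ ∪ C.cloc) → Step (.ite ρ C C₁ C₂) R (.ite ρ C C₁' C₂')
  | appI {C₁ C₂ C₂' R} : Step C₂ R C₂' → Disjoint R.rloc C₁.cloc →
      Step (.app C₁ C₂) (.arg R) (.app C₁ C₂')
  | pairI {C₁ C₂ C₂' R} : Step C₂ R C₂' → Disjoint R.rloc C₁.cloc →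
      Step (.pair C₁ C₂) (.pairR R) (.pair C₁ C₂')

end Calculus

end LambdaQC

universe u v w

/-! Preservation is an induction on the step. The β-rules reduce to four closure properties of
typing: substitution of types (`Typed.tsubst`), of local expressions (`Typed.esubst`), renaming of
choreographic variables (`Typed.rename`) and substitution for them (`Typed.subst`). Out-of-order
steps follow from the induction hypothesis, except for what they do to the local context.

The delicate rule is communication. In `ρ₁.v ⇝_ℓ ρ₂` the value `v` is typed with the declarations
visible to all of `ρ₁`, but the result `(ρ₁ ∪ ρ₂).v` sees only those visible to the larger set. So
`v` must be typable without local variables. This is immediate if local values are closed. Otherwise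
one starts from an empty local context, yet an out-of-order step under `let ρ.x` takes place in a
nonempty one. Its side condition saves the argument: the blocked locations of the redex are disjoint
from those possibly in `ρ`. Hence the induction carries the invariant `Avoids R S`: the redex blocks
no location at which a variable of `S` is bound. If `ℓ` sends from `ρ₁` and some declaration `ρ'.x`
with `ρ₁ ⊆ ρ'` were visible, then `ℓ ∈ ρ'`, while `ℓ` is blocked by the send; this contradicts the
invariant (`Avoids.proj_eq_none`).

Progress is an induction on typing in empty contexts, by canonical forms and local progress.
In-order reduction suffices there. -/

namespace LambdaQC

variable {Loc : Type u} {𝕃 : LocalLang.{u, v, w} Loc}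

/-! ### Substitution calculus for types, locations and location sets. -/

namespace CTy

theorem up_var (ξ : ℕ → ℕ) :
    up (fun n => (var (ξ n) : CTy 𝕃)) = fun n => var (upRen ξ n) := by
  funext n; cases n <;> rfl

theorem rename_eq_subst (ξ : ℕ → ℕ) (τ : CTy 𝕃) : τ.rename ξ = τ.subst fun n => var (ξ n) := by
  induction τ generalizing ξ <;> simp_all [rename, subst, up_var, toLocal]

theorem subst_id (τ : CTy 𝕃) : τ.subst var = τ := by
  have h : up (var : ℕ → CTy 𝕃) = var := by funext n; cases n <;> rfl
  induction τ <;> simp_all [subst, toLocal, 𝕃.tySubst_id]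

/-- No kinding assumption is needed because the default value `boolTy` of `toLocal` is invariant
under substitution. This makes the composition laws below unconditional. -/
theorem toLocal_subst (σ : ℕ → CTy 𝕃) (τ : CTy 𝕃) :
    (τ.subst σ).toLocal = 𝕃.tySubst (fun n => (σ n).toLocal) τ.toLocal := by
  cases τ <;> simp [subst, toLocal, 𝕃.tySubst_tvar, 𝕃.subst_boolTy]

theorem toLocal_rename (ξ : ℕ → ℕ) (τ : CTy 𝕃) :
    (τ.rename ξ).toLocal = 𝕃.tySubst (fun n => 𝕃.tvar (ξ n)) τ.toLocal := by
  rw [rename_eq_subst, toLocal_subst]; rfl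

theorem rename_subst (ξ : ℕ → ℕ) (σ : ℕ → CTy 𝕃) (τ : CTy 𝕃) :
    (τ.rename ξ).subst σ = τ.subst fun n => σ (ξ n) := by
  have h (ξ : ℕ → ℕ) (σ : ℕ → CTy 𝕃) : (fun n => up σ (upRen ξ n)) = up fun n => σ (ξ n) := by
    funext n; cases n <;> rfl
  induction τ generalizing ξ σ <;>
    simp_all [rename, subst, 𝕃.tySubst_comp, 𝕃.tySubst_tvar]

theorem rename_rename (ξ ζ : ℕ → ℕ) (τ : CTy 𝕃) :
    (τ.rename ξ).rename ζ = τ.rename fun n => ζ (ξ n) := by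
  rw [rename_eq_subst ζ, rename_subst, rename_eq_subst]

theorem subst_rename (σ : ℕ → CTy 𝕃) (ξ : ℕ → ℕ) (τ : CTy 𝕃) :
    (τ.subst σ).rename ξ = τ.subst fun n => (σ n).rename ξ := by
  have h (σ : ℕ → CTy 𝕃) (ξ : ℕ → ℕ) :
      (fun n => (up σ n).rename (upRen ξ)) = up fun n => (σ n).rename ξ := by
    funext n
    cases n with
    | zero => rfl
    | succ n => simp [up, shift, rename_rename, upRen]
  induction τ generalizing ξ σ <;>
    simp_all [rename, subst, 𝕃.tySubst_comp, toLocal_rename]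

theorem shift_subst_up (σ : ℕ → CTy 𝕃) (τ : CTy 𝕃) : τ.shift.subst (up σ) = (τ.subst σ).shift := by
  rw [shift, shift, rename_subst, subst_rename]; rfl

theorem subst_subst (σ θ : ℕ → CTy 𝕃) (τ : CTy 𝕃) :
    (τ.subst σ).subst θ = τ.subst fun n => (σ n).subst θ := by
  have h (σ θ : ℕ → CTy 𝕃) : (fun n => (up σ n).subst (up θ)) = up fun n => (σ n).subst θ := by
    funext n
    cases n with
    | zero => rfl
    | succ n => exact shift_subst_up θ (σ n)
  induction τ generalizing σ θ <;>
    simp_all [subst, 𝕃.tySubst_comp, toLocal_subst]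

theorem shift_subst_one (t τ : CTy 𝕃) : τ.shift.subst (one t) = τ := by
  rw [shift, rename_subst]; exact subst_id τ

/-- Needed where a typing rule itself instantiates a type: type application, `fold` and `unfold`. -/
theorem subst_one_subst (σ : ℕ → CTy 𝕃) (t τ : CTy 𝕃) :
    (τ.subst (one t)).subst σ = (τ.subst (up σ)).subst (one (t.subst σ)) := by
  rw [subst_subst, subst_subst]
  congr 1
  funext n
  cases n with
  | zero => rfl
  | succ n => exact (shift_subst_one _ _).symm

theorem shift_eq_subst (τ : CTy 𝕃) : τ.shift = τ.subst fun n => var (n + 1) :=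
  rename_eq_subst _ τ

theorem ofFinset_subst (σ : ℕ → CTy 𝕃) (A : Finset Loc) :
    (ofFinset A : CTy 𝕃).subst σ = ofFinset A := by
  unfold ofFinset
  induction A.toList <;> simp_all [subst]

end CTy

/-! ### Containment of locations in location sets. -/

theorem Nec.subst {l ρ : CTy 𝕃} (σ : ℕ → CTy 𝕃) (h : Nec l ρ) : Nec (l.subst σ) (ρ.subst σ) := by
  induction h with
  | sng => exact .sng _
  | left _ ih => exact .left ih
  | right _ ih => exact .right ih

theorem SubLoc.subst {ρ₁ ρ₂ : CTy 𝕃} (σ : ℕ → CTy 𝕃) (h : SubLoc ρ₁ ρ₂) :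
    SubLoc (ρ₁.subst σ) (ρ₂.subst σ) := by
  induction h with
  | empty => exact .empty _
  | refl => exact .refl _
  | left _ ih => exact .left ih
  | right _ ih => exact .right ih
  | sng h => exact .sng (h.subst σ)
  | union _ _ ih₁ ih₂ => exact .union ih₁ ih₂

theorem Nec.mono {l ρ₁ ρ₂ : CTy 𝕃} (h : Nec l ρ₁) (hs : SubLoc ρ₁ ρ₂) : Nec l ρ₂ := by
  induction hs with
  | empty => cases h
  | refl => exact h
  | left _ ih => exact .left (ih h)
  | right _ ih => exact .right (ih h)
  | sng h' => cases h; exact h'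
  | union _ _ ih₁ ih₂ =>
    cases h with
    | left h => exact ih₁ h
    | right h => exact ih₂ h

/-- The inversion that transitivity needs. It is not plain case analysis: reflexivity and the two
rules acting on the right-hand side can also conclude with a union on the left. -/
theorem SubLoc.of_union {ρ₁ ρ₂ ρ : CTy 𝕃} (h : SubLoc (.union ρ₁ ρ₂) ρ) :
    SubLoc ρ₁ ρ ∧ SubLoc ρ₂ ρ := by
  generalize hu : CTy.union ρ₁ ρ₂ = u at h
  induction h with
  | empty => cases hu
  | refl => subst hu; exact ⟨.left (.refl _), .right (.refl _)⟩
  | left _ ih => exact ⟨.left (ih hu).1, .left (ih hu).2⟩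
  | right _ ih => exact ⟨.right (ih hu).1, .right (ih hu).2⟩
  | sng => cases hu
  | union h₁ h₂ => cases hu; exact ⟨h₁, h₂⟩

theorem SubLoc.trans {ρ₁ ρ₂ ρ₃ : CTy 𝕃} (h₁ : SubLoc ρ₁ ρ₂) (h₂ : SubLoc ρ₂ ρ₃) :
    SubLoc ρ₁ ρ₃ := by
  induction h₁ with
  | empty => exact .empty _
  | refl => exact h₂
  | left _ ih => exact ih h₂.of_union.1
  | right _ ih => exact ih h₂.of_union.2
  | sng h => exact .sng (h.mono h₂)
  | union _ _ ih₁ ih₂ => exact .union (ih₁ h₂) (ih₂ h₂)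

/-- Possible containment does not depend on the names of variables. -/
theorem poss_rename (ξ : ℕ → ℕ) (ρ : CTy 𝕃) : poss (ρ.rename ξ) = poss ρ := by
  ext l
  constructor <;> intro h
  · change Poss l (ρ.rename ξ) at h
    change Poss l ρ
    induction ρ with
    | var => exact .var _ _
    | sng l' =>
      -- Only a variable or a name inside a singleton has a rule for possible containment; all other
      -- shapes vanish.
      cases l' <;> cases h
      · exact .sngVar _ _
      · exact .sngLoc _
    | union _ _ ih₁ ih₂ =>
      cases h with
      | left h => exact .left (ih₁ h)
      | right h => exact .right (ih₂ h)
    | _ => cases h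
  · induction h with
    | var => exact .var _ _
    | sngVar => exact .sngVar _ _
    | sngLoc => exact .sngLoc _
    | left _ ih => exact .left ih
    | right _ ih => exact .right ih

/-! ### Kinding under renaming, substitution and strengthening. -/

theorem localKinds_toLocal {Γ : List Kind} {t : CTy 𝕃} (h : Kinded Γ t .lty) :
    𝕃.Kinded (localKinds Γ) t.toLocal := by
  cases h with
  | var h => exact 𝕃.kinded_tvar _ _ h
  | lty h => exact h

theorem Kinded.rename {Γ : List Kind} {τ : CTy 𝕃} {κ : Kind} (h : Kinded Γ τ κ) :
    ∀ {Γ' : List Kind} {ξ : ℕ → ℕ}, (∀ n κ, Γ[n]? = some κ → Γ'[ξ n]? = some κ) →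
      Kinded Γ' (τ.rename ξ) κ := by
  have hup {Γ Γ' : List Kind} {ξ : ℕ → ℕ} (κ : Kind)
      (hξ : ∀ n κ, Γ[n]? = some κ → Γ'[ξ n]? = some κ) :
      ∀ n κ', (κ :: Γ)[n]? = some κ' → (κ :: Γ')[upRen ξ n]? = some κ' := by
    intro n κ' h
    cases n with
    | zero => exact h
    | succ n => exact hξ n κ' h
  induction h with
  | var h => intro Γ' ξ hξ; exact .var (hξ _ _ h)
  | lty h =>
    intro Γ' ξ hξ
    exact .lty (𝕃.kinded_subst _ _ _ _ h fun α hα => 𝕃.kinded_tvar _ _ (hξ _ _ hα))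
  | located _ _ ih₁ ih₂ => intro Γ' ξ hξ; exact .located (ih₁ hξ) (ih₂ hξ)
  | arr _ _ ih₁ ih₂ => intro Γ' ξ hξ; exact .arr (ih₁ hξ) (ih₂ hξ)
  | all _ ih => intro Γ' ξ hξ; exact .all (ih (hup _ hξ))
  | prod _ _ ih₁ ih₂ => intro Γ' ξ hξ; exact .prod (ih₁ hξ) (ih₂ hξ)
  | sum _ _ ih₁ ih₂ => intro Γ' ξ hξ; exact .sum (ih₁ hξ) (ih₂ hξ)
  | mu _ ih => intro Γ' ξ hξ; exact .mu (ih (hup _ hξ))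
  | loc L => intro Γ' ξ hξ; exact .loc L
  | empty => intro Γ' ξ hξ; exact .empty
  | sng _ ih => intro Γ' ξ hξ; exact .sng (ih hξ)
  | union _ _ ih₁ ih₂ => intro Γ' ξ hξ; exact .union (ih₁ hξ) (ih₂ hξ)

theorem Kinded.shift {Γ : List Kind} {τ : CTy 𝕃} {κ : Kind} (κ' : Kind) (h : Kinded Γ τ κ) :
    Kinded (κ' :: Γ) τ.shift κ :=
  h.rename fun _ _ h => h

theorem Kinded.up {Γ Γ' : List Kind} {σ : ℕ → CTy 𝕃} (κ : Kind)
    (hσ : ∀ n κ, Γ[n]? = some κ → Kinded Γ' (σ n) κ) :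
    ∀ n κ', (κ :: Γ)[n]? = some κ' → Kinded (κ :: Γ') (CTy.up σ n) κ' := by
  intro n κ' h
  cases n with
  | zero => exact .var h
  | succ n => exact (hσ n κ' h).shift κ

theorem Kinded.subst {Γ : List Kind} {τ : CTy 𝕃} {κ : Kind} (h : Kinded Γ τ κ) :
    ∀ {Γ' : List Kind} {σ : ℕ → CTy 𝕃}, (∀ n κ, Γ[n]? = some κ → Kinded Γ' (σ n) κ) →
      Kinded Γ' (τ.subst σ) κ := by
  induction h with
  | var h => intro Γ' σ hσ; exact hσ _ _ h
  | lty h =>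
    intro Γ' σ hσ
    exact .lty (𝕃.kinded_subst _ _ _ _ h fun α hα => localKinds_toLocal (hσ _ _ hα))
  | located _ _ ih₁ ih₂ => intro Γ' σ hσ; exact .located (ih₁ hσ) (ih₂ hσ)
  | arr _ _ ih₁ ih₂ => intro Γ' σ hσ; exact .arr (ih₁ hσ) (ih₂ hσ)
  | all _ ih => intro Γ' σ hσ; exact .all (ih (Kinded.up _ hσ))
  | prod _ _ ih₁ ih₂ => intro Γ' σ hσ; exact .prod (ih₁ hσ) (ih₂ hσ)
  | sum _ _ ih₁ ih₂ => intro Γ' σ hσ; exact .sum (ih₁ hσ) (ih₂ hσ)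
  | mu _ ih => intro Γ' σ hσ; exact .mu (ih (Kinded.up _ hσ))
  | loc L => intro Γ' σ hσ; exact .loc L
  | empty => intro Γ' σ hσ; exact .empty
  | sng _ ih => intro Γ' σ hσ; exact .sng (ih hσ)
  | union _ _ ih₁ ih₂ => intro Γ' σ hσ; exact .union (ih₁ hσ) (ih₂ hσ)

/-- Strengthening: variables outside the range of an injective renaming are irrelevant, since every
context has a well-kinded local type to put for them. -/
theorem Kinded.of_rename {τ : CTy 𝕃} : ∀ {Γ Γ' : List Kind} {ξ : ℕ → ℕ} {κ : Kind},
    Function.Injective ξ → (∀ n κ, Γ[ξ n]? = some κ → Γ'[n]? = some κ) →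
      Kinded Γ (τ.rename ξ) κ → Kinded Γ' τ κ := by
  have hlty {t : 𝕃.Ty} {Γ Γ' : List Kind} {ξ : ℕ → ℕ} (hξ : Function.Injective ξ)
      (hΓ : ∀ n κ, Γ[ξ n]? = some κ → Γ'[n]? = some κ)
      (h : 𝕃.Kinded (localKinds Γ) (𝕃.tySubst (fun n => 𝕃.tvar (ξ n)) t)) :
      𝕃.Kinded (localKinds Γ') t := by
    classical
    -- A substitution that undoes `ξ`; variables outside its range go to `boolTy`, which is
    -- well-kinded everywhere.
    let θ : ℕ → 𝕃.Ty := fun m => if h : ∃ n, ξ n = m then 𝕃.tvar h.choose else 𝕃.boolTy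
    have hθ (n) : θ (ξ n) = 𝕃.tvar n := by
      have hn : ∃ k, ξ k = ξ n := ⟨n, rfl⟩
      simp only [θ, dif_pos hn]
      rw [hξ hn.choose_spec]
    have := 𝕃.kinded_subst _ (localKinds Γ') θ _ h fun α hα => by
      by_cases hn : ∃ n, ξ n = α
      · obtain ⟨n, rfl⟩ := hn
        rw [hθ]
        exact 𝕃.kinded_tvar _ _ (hΓ _ _ hα)
      · simp only [θ, dif_neg hn]
        exact 𝕃.kinded_boolTy _
    simpa only [𝕃.tySubst_comp, 𝕃.tySubst_tvar, hθ, 𝕃.tySubst_id] using this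
  have hinj {ξ : ℕ → ℕ} (hξ : Function.Injective ξ) : Function.Injective (upRen ξ) := by
    rintro (_ | a) (_ | b) h
    · rfl
    · cases h
    · cases h
    · exact congrArg _ (hξ (Nat.succ.inj h))
  have hup {Γ Γ' : List Kind} {ξ : ℕ → ℕ} (κ : Kind)
      (hΓ : ∀ n κ, Γ[ξ n]? = some κ → Γ'[n]? = some κ) :
      ∀ n κ', (κ :: Γ)[upRen ξ n]? = some κ' → (κ :: Γ')[n]? = some κ' := by
    intro n κ' h
    cases n with
    | zero => exact h
    | succ n => exact hΓ n κ' h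
  induction τ with
  | var => intro Γ Γ' ξ κ hξ hΓ h; cases h with | var h => exact .var (hΓ _ _ h)
  | lty => intro Γ Γ' ξ κ hξ hΓ h; cases h with | lty h => exact .lty (hlty hξ hΓ h)
  | located _ _ ih =>
    intro Γ Γ' ξ κ hξ hΓ h
    cases h with
    | located h₁ h₂ =>
      cases h₁ with | lty h₁ => exact .located (.lty (hlty hξ hΓ h₁)) (ih hξ hΓ h₂)
  | arr _ _ ih₁ ih₂ =>
    intro Γ Γ' ξ κ hξ hΓ h
    cases h with | arr h₁ h₂ => exact .arr (ih₁ hξ hΓ h₁) (ih₂ hξ hΓ h₂)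
  | all _ _ ih =>
    intro Γ Γ' ξ κ hξ hΓ h
    cases h with | all h => exact .all (ih (hinj hξ) (hup _ hΓ) h)
  | prod _ _ ih₁ ih₂ =>
    intro Γ Γ' ξ κ hξ hΓ h
    cases h with | prod h₁ h₂ => exact .prod (ih₁ hξ hΓ h₁) (ih₂ hξ hΓ h₂)
  | sum _ _ ih₁ ih₂ =>
    intro Γ Γ' ξ κ hξ hΓ h
    cases h with | sum h₁ h₂ => exact .sum (ih₁ hξ hΓ h₁) (ih₂ hξ hΓ h₂)
  | mu _ ih =>
    intro Γ Γ' ξ κ hξ hΓ h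
    cases h with | mu h => exact .mu (ih (hinj hξ) (hup _ hΓ) h)
  | loc => intro Γ Γ' ξ κ hξ hΓ h; cases h; exact .loc _
  | empty => intro Γ Γ' ξ κ hξ hΓ h; cases h; exact .empty
  | sng _ ih => intro Γ Γ' ξ κ hξ hΓ h; cases h with | sng h => exact .sng (ih hξ hΓ h)
  | union _ _ ih₁ ih₂ =>
    intro Γ Γ' ξ κ hξ hΓ h
    cases h with | union h₁ h₂ => exact .union (ih₁ hξ hΓ h₁) (ih₂ hξ hΓ h₂)

theorem Kinded.of_shift {Γ : List Kind} {τ : CTy 𝕃} {κ κ' : Kind}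
    (h : Kinded (κ' :: Γ) τ.shift κ) : Kinded Γ τ κ :=
  Kinded.of_rename Nat.succ_injective (fun _ _ h => h) h

theorem Kinded.one {Γ : List Kind} {t : CTy 𝕃} {κ : Kind} (h : Kinded Γ t κ) :
    ∀ n κ', (κ :: Γ)[n]? = some κ' → Kinded Γ (CTy.one t n) κ' := by
  intro n κ' hn
  cases n with
  | zero => cases hn; exact h
  | succ n => exact .var hn

theorem Kinded.ofFinset (Γ : List Kind) (A : Finset Loc) :
    Kinded Γ (CTy.ofFinset A : CTy 𝕃) .locSet := by
  unfold CTy.ofFinset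
  induction A.toList with
  | nil => exact .empty
  | cons L _ ih => exact .union (.sng (.loc L)) ih

theorem Kinded.of_nec {Γ : List Kind} {l ρ : CTy 𝕃} (hn : Nec l ρ) (h : Kinded Γ ρ .locSet) :
    Kinded Γ l .loc := by
  induction hn with
  | sng => cases h with | sng h => exact h
  | left _ ih => cases h with | union h₁ h₂ => exact ih h₁
  | right _ ih => cases h with | union h₁ h₂ => exact ih h₂

/-- Kinding matters: a term of kind `loc` is a variable or a name, the only two singleton contents
for which possible containment has a rule. -/
theorem Poss.of_nec {Γ : List Kind} {l ρ : CTy 𝕃} (hl : Kinded Γ l .loc) (h : Nec l ρ) :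
    Poss l ρ := by
  induction h with
  | sng =>
    cases hl with
    | var => exact .sngVar _ _
    | loc L => exact .sngLoc L
  | left _ ih => exact .left ih
  | right _ ih => exact .right ih

/-! ### Well-formed contexts and projections of local contexts. -/

/-- A derivation may interleave the entries of `Δ` and `S` in any order; the pointwise form forgets
the order, so entries can be removed freely. -/
theorem wf_iff {Γ : List Kind} {Δ : List (CTy 𝕃)} {S : LCtx 𝕃} :
    WF Γ Δ S ↔ (∀ τ ∈ Δ, Kinded Γ τ .chor) ∧
      ∀ p ∈ S, Kinded Γ p.1 .locSet ∧ Kinded Γ (.lty p.2 : CTy 𝕃) .lty := by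
  constructor
  · intro h
    induction h with
    | nil => simp
    | add _ h ih => exact ⟨by simpa using ⟨h, ih.1⟩, ih.2⟩
    | addLocal _ h₁ h₂ ih => exact ⟨ih.1, by simpa using ⟨⟨h₁, h₂⟩, by simpa using ih.2⟩⟩
  · rintro ⟨hΔ, hS⟩
    induction S with
    | nil =>
      clear hS
      induction Δ with
      | nil => exact .nil
      | cons τ Δ ih =>
        exact .add (ih fun τ h => hΔ τ (List.mem_cons_of_mem _ h)) (hΔ τ List.mem_cons_self)
    | cons p S ih =>
      have hp := hS p List.mem_cons_self
      exact .addLocal (ih fun p h => hS p (List.mem_cons_of_mem _ h)) hp.1 hp.2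

theorem WF.tail {Γ : List Kind} {Δ : List (CTy 𝕃)} {S : LCtx 𝕃} {τ : CTy 𝕃}
    (h : WF Γ (τ :: Δ) S) : WF Γ Δ S := by
  rw [wf_iff] at h ⊢
  exact ⟨fun τ hτ => h.1 τ (List.mem_cons_of_mem _ hτ), h.2⟩

theorem WF.head {Γ : List Kind} {Δ : List (CTy 𝕃)} {S : LCtx 𝕃} {τ : CTy 𝕃}
    (h : WF Γ (τ :: Δ) S) : Kinded Γ τ .chor :=
  (wf_iff.1 h).1 τ List.mem_cons_self

theorem WF.localHead {Γ : List Kind} {Δ : List (CTy 𝕃)} {S : LCtx 𝕃} {p : CTy 𝕃 × 𝕃.Ty}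
    (h : WF Γ Δ (p :: S)) : Kinded Γ p.1 .locSet ∧ Kinded Γ (.lty p.2 : CTy 𝕃) .lty :=
  (wf_iff.1 h).2 p List.mem_cons_self

/-- Substitution of types in a local context. -/
def LCtx.tsubst (σ : ℕ → CTy 𝕃) (S : LCtx 𝕃) : LCtx 𝕃 :=
  S.map fun p => (p.1.subst σ, 𝕃.tySubst (fun n => (σ n).toLocal) p.2)

theorem LCtx.shift_eq_tsubst (S : LCtx 𝕃) : S.shift = S.tsubst fun n => .var (n + 1) :=
  List.map_congr_left fun p _ => by rw [CTy.shift_eq_subst]; rfl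

theorem LCtx.tsubst_tsubst (σ θ : ℕ → CTy 𝕃) (S : LCtx 𝕃) :
    (S.tsubst σ).tsubst θ = S.tsubst fun n => (σ n).subst θ := by
  simp [LCtx.tsubst, CTy.subst_subst, 𝕃.tySubst_comp, CTy.toLocal_subst]

theorem LCtx.tsubst_var (S : LCtx 𝕃) : S.tsubst CTy.var = S := by
  simp [LCtx.tsubst, CTy.subst_id, CTy.toLocal, 𝕃.tySubst_id]

theorem LCtx.shift_tsubst_up (σ : ℕ → CTy 𝕃) (S : LCtx 𝕃) :
    S.shift.tsubst (CTy.up σ) = (S.tsubst σ).shift := by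
  rw [shift_eq_tsubst, shift_eq_tsubst, tsubst_tsubst, tsubst_tsubst]
  congr 1
  funext n
  exact CTy.shift_eq_subst _

theorem LCtx.shift_tsubst_one (t : CTy 𝕃) (S : LCtx 𝕃) : S.shift.tsubst (CTy.one t) = S := by
  rw [shift_eq_tsubst, tsubst_tsubst]
  exact tsubst_var S

theorem map_shift_subst_up (σ : ℕ → CTy 𝕃) (Δ : List (CTy 𝕃)) :
    (Δ.map CTy.shift).map (CTy.subst (CTy.up σ)) = (Δ.map (CTy.subst σ)).map CTy.shift := by
  simp [CTy.shift_subst_up]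

theorem map_shift_subst_one (t : CTy 𝕃) (Δ : List (CTy 𝕃)) :
    (Δ.map CTy.shift).map (CTy.subst (CTy.one t)) = Δ := by
  rw [List.map_map]
  exact (List.map_congr_left fun τ _ => CTy.shift_subst_one t τ).trans (List.map_id' Δ)

theorem WF.tsubst {Γ Γ' : List Kind} {Δ : List (CTy 𝕃)} {S : LCtx 𝕃} {σ : ℕ → CTy 𝕃}
    (h : WF Γ Δ S) (hσ : ∀ n κ, Γ[n]? = some κ → Kinded Γ' (σ n) κ) :
    WF Γ' (Δ.map (CTy.subst σ)) (S.tsubst σ) := by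
  induction h with
  | nil => exact .nil
  | add _ h ih => exact .add ih (h.subst hσ)
  | addLocal _ h₁ h₂ ih => exact .addLocal ih (h₁.subst hσ) (h₂.subst hσ)

theorem WF.shift {Γ : List Kind} {Δ : List (CTy 𝕃)} {S : LCtx 𝕃} (κ : Kind) (h : WF Γ Δ S) :
    WF (κ :: Γ) (Δ.map CTy.shift) S.shift := by
  rw [LCtx.shift_eq_tsubst, List.map_congr_left fun τ _ => CTy.shift_eq_subst τ]
  exact h.tsubst fun n κ h => .var h

theorem WF.of_shift {Γ : List Kind} {Δ : List (CTy 𝕃)} {S : LCtx 𝕃} {κ : Kind}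
    (h : WF (κ :: Γ) (Δ.map CTy.shift) S.shift) : WF Γ Δ S := by
  rw [wf_iff] at h ⊢
  refine ⟨fun τ hτ => (h.1 _ (List.mem_map_of_mem hτ)).of_shift, fun p hp => ?_⟩
  have := h.2 _ (List.mem_map_of_mem hp)
  exact ⟨this.1.of_shift, Kinded.of_shift this.2⟩

theorem LCtx.proj_eq_some {S : LCtx 𝕃} {ρ : CTy 𝕃} {x : ℕ} {t : 𝕃.Ty} :
    S.proj ρ x = some t ↔ ∃ ρ', S[x]? = some (ρ', t) ∧ SubLoc ρ ρ' := by
  unfold LCtx.proj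
  rcases h : S[x]? with _ | ⟨ρ', t'⟩
  · simp
  · by_cases hs : SubLoc ρ ρ'
    · simp only [if_pos hs, Option.some.injEq, Prod.mk.injEq]
      constructor
      · rintro rfl; exact ⟨ρ', ⟨rfl, rfl⟩, hs⟩
      · rintro ⟨_, ⟨_, rfl⟩, _⟩; rfl
    · simp only [if_neg hs, Option.some.injEq, Prod.mk.injEq, reduceCtorEq, false_iff]
      rintro ⟨_, ⟨rfl, _⟩, h⟩
      exact hs h

/-- Projection is antitone: fewer locations share more variables. This is where transitivity of
`SubLoc` is used. -/
theorem LCtx.proj_mono {S : LCtx 𝕃} {ρ₁ ρ₂ : CTy 𝕃} (h : SubLoc ρ₁ ρ₂) (x : ℕ) (t : 𝕃.Ty)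
    (hx : S.proj ρ₂ x = some t) : S.proj ρ₁ x = some t := by
  obtain ⟨ρ, hx, hρ⟩ := proj_eq_some.1 hx
  exact proj_eq_some.2 ⟨ρ, hx, h.trans hρ⟩

theorem LCtx.getElem?_tsubst {S : LCtx 𝕃} {x : ℕ} {ρ : CTy 𝕃} {t : 𝕃.Ty} (σ : ℕ → CTy 𝕃)
    (h : S[x]? = some (ρ, t)) :
    (S.tsubst σ)[x]? = some (ρ.subst σ, 𝕃.tySubst (fun n => (σ n).toLocal) t) := by
  simp [LCtx.tsubst, h]

/-- Only one direction holds: substitution preserves containments but may create new ones, so the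
projection can grow. -/
theorem LCtx.proj_tsubst {S : LCtx 𝕃} {ρ : CTy 𝕃} {x : ℕ} {t : 𝕃.Ty} (σ : ℕ → CTy 𝕃)
    (h : (S.proj ρ x).map (𝕃.tySubst fun n => (σ n).toLocal) = some t) :
    (S.tsubst σ).proj (ρ.subst σ) x = some t := by
  obtain ⟨t, ht, rfl⟩ := Option.map_eq_some_iff.1 h
  obtain ⟨ρ', hx, hs⟩ := proj_eq_some.1 ht
  exact proj_eq_some.2 ⟨_, getElem?_tsubst σ hx, hs.subst σ⟩

theorem WF.kinded_proj {Γ : List Kind} {Δ : List (CTy 𝕃)} {S : LCtx 𝕃} (h : WF Γ Δ S) (ρ : CTy 𝕃)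
    (x : ℕ) (t : 𝕃.Ty) (hx : S.proj ρ x = some t) : 𝕃.Kinded (localKinds Γ) t := by
  obtain ⟨ρ', hx, -⟩ := LCtx.proj_eq_some.1 hx
  exact localKinds_toLocal ((wf_iff.1 h).2 _ (List.mem_of_getElem? hx)).2

/-- Weakening is the substitution lemma for the identity substitution. -/
theorem LocalLang.typed_mono {Γ : Set ℕ} {S S' : ℕ → Option 𝕃.Ty} {e : 𝕃.Expr} {t : 𝕃.Ty}
    (h : 𝕃.Typed Γ S e t) (hS : ∀ x s, S x = some s → S' x = some s)
    (hS' : ∀ x s, S' x = some s → 𝕃.Kinded Γ s) : 𝕃.Typed Γ S' e t := by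
  simpa only [𝕃.subst_id] using
    𝕃.typed_subst _ _ _ 𝕃.var _ _ h hS' fun x s hx => 𝕃.typed_var _ _ _ _ hS' (hS x s hx)

/-! ### Typing under substitution of types. -/

theorem Typed.wf {Γ : List Kind} {Δ : List (CTy 𝕃)} {S : LCtx 𝕃} {C : Chor 𝕃} {τ : CTy 𝕃}
    (h : Typed Γ Δ S C τ) : WF Γ Δ S := by
  induction h with
  | var h => exact h
  | comp h => exact h
  | fn _ ih => exact ih.tail.tail
  -- The only premise lives over the extended kinding context, so strengthening is required.
  | tabs _ ih => exact ih.of_shift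
  | _ => assumption

theorem Typed.tsubst {Γ : List Kind} {Δ : List (CTy 𝕃)} {S : LCtx 𝕃} {C : Chor 𝕃} {τ : CTy 𝕃}
    (h : Typed Γ Δ S C τ) : ∀ {Γ' : List Kind} {σ : ℕ → CTy 𝕃},
      (∀ n κ, Γ[n]? = some κ → Kinded Γ' (σ n) κ) →
      Typed Γ' (Δ.map (CTy.subst σ)) (S.tsubst σ) (C.tsubst σ) (τ.subst σ) := by
  induction h with
  | var h hn => intro Γ' σ hσ; exact .var (h.tsubst hσ) (by simp [hn])
  | comp h hρ he =>
    intro Γ' σ hσ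
    refine .comp (h.tsubst hσ) (hρ.subst hσ) ?_
    -- The local language yields a typing in the image of the old projection; weakening moves it to
    -- the possibly larger projection of the substituted context.
    exact LocalLang.typed_mono
      (𝕃.typed_instTy _ (localKinds Γ') _ _ _ _ he fun α hα => localKinds_toLocal (hσ _ _ hα))
      (fun x s => LCtx.proj_tsubst σ) ((h.tsubst hσ).kinded_proj _)
  | fn _ ih => intro Γ' σ hσ; exact .fn (ih hσ)
  | app _ _ ih₁ ih₂ => intro Γ' σ hσ; exact .app (ih₁ hσ) (ih₂ hσ)
  | tabs _ ih =>
    intro Γ' σ hσ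
    refine .tabs ?_
    rw [← map_shift_subst_up, ← LCtx.shift_tsubst_up]
    exact ih (Kinded.up _ hσ)
  | tapp _ ht ih =>
    intro Γ' σ hσ
    rw [CTy.subst_one_subst]
    exact .tapp (ih hσ) (ht.subst hσ)
  | fold hk _ ih =>
    intro Γ' σ hσ
    refine .fold (hk.subst hσ) ?_
    have := ih hσ
    rwa [CTy.subst_one_subst] at this
  | unfold _ ih =>
    intro Γ' σ hσ
    rw [CTy.subst_one_subst]
    exact .unfold (ih hσ)
  | pair _ _ ih₁ ih₂ => intro Γ' σ hσ; exact .pair (ih₁ hσ) (ih₂ hσ)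
  | fst _ ih => intro Γ' σ hσ; exact .fst (ih hσ)
  | snd _ ih => intro Γ' σ hσ; exact .snd (ih hσ)
  | inl _ hk ih => intro Γ' σ hσ; exact .inl (ih hσ) (hk.subst hσ)
  | inr _ hk ih => intro Γ' σ hσ; exact .inr (ih hσ) (hk.subst hσ)
  | caseOf _ _ _ ih ih₁ ih₂ => intro Γ' σ hσ; exact .caseOf (ih hσ) (ih₁ hσ) (ih₂ hσ)
  | letE _ hs _ ih₁ ih₂ => intro Γ' σ hσ; exact .letE (ih₁ hσ) (hs.subst σ) (ih₂ hσ)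
  | letLoc _ hs hA hk _ ih₁ ih₂ =>
    intro Γ' σ hσ
    have h₁ := ih₁ hσ
    have h₂ := ih₂ (Kinded.up _ hσ)
    have hA := hA.subst σ
    rw [CTy.ofFinset_subst] at hA
    rw [map_shift_subst_up, LCtx.shift_tsubst_up, CTy.shift_subst_up] at h₂
    simp only [CTy.subst, 𝕃.subst_locTy] at h₁
    exact .letLoc h₁ (hs.subst σ) hA (hk.subst hσ) h₂
  | letLocSet _ hs hA hk _ ih₁ ih₂ =>
    intro Γ' σ hσ
    have h₁ := ih₁ hσ
    have h₂ := ih₂ (Kinded.up _ hσ)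
    have hA := hA.subst σ
    rw [CTy.ofFinset_subst] at hA
    rw [map_shift_subst_up, LCtx.shift_tsubst_up, CTy.shift_subst_up] at h₂
    simp only [CTy.subst, 𝕃.subst_locSetTy] at h₁
    exact .letLocSet h₁ (hs.subst σ) hA (hk.subst hσ) h₂
  | letLocalTy _ hs hk _ ih₁ ih₂ =>
    intro Γ' σ hσ
    have h₁ := ih₁ hσ
    have h₂ := ih₂ (Kinded.up _ hσ)
    rw [map_shift_subst_up, LCtx.shift_tsubst_up, CTy.shift_subst_up] at h₂
    simp only [CTy.subst, 𝕃.subst_repTy] at h₁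
    exact .letLocalTy h₁ (hs.subst σ) (hk.subst hσ) h₂
  | send _ hn hk ih => intro Γ' σ hσ; exact .send (ih hσ) (hn.subst σ) (hk.subst hσ)
  | sync hl hk _ ih => intro Γ' σ hσ; exact .sync (hl.subst hσ) (hk.subst hσ) (ih hσ)
  | ite _ hs _ _ ih ih₁ ih₂ =>
    intro Γ' σ hσ
    have h := ih hσ
    simp only [CTy.subst, 𝕃.subst_boolTy] at h
    exact .ite h (hs.subst σ) (ih₁ hσ) (ih₂ hσ)

theorem Typed.shiftT {Γ : List Kind} {Δ : List (CTy 𝕃)} {S : LCtx 𝕃} {C : Chor 𝕃} {τ : CTy 𝕃}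
    (κ : Kind) (h : Typed Γ Δ S C τ) :
    Typed (κ :: Γ) (Δ.map CTy.shift) S.shift C.shiftT τ.shift := by
  rw [LCtx.shift_eq_tsubst, List.map_congr_left fun τ _ => CTy.shift_eq_subst τ,
    CTy.shift_eq_subst]
  exact h.tsubst fun n κ h => .var h

theorem Typed.tsubst_one {Γ : List Kind} {Δ : List (CTy 𝕃)} {S : LCtx 𝕃} {C : Chor 𝕃}
    {τ t : CTy 𝕃} {κ : Kind} (h : Typed (κ :: Γ) (Δ.map CTy.shift) S.shift C τ)
    (ht : Kinded Γ t κ) : Typed Γ Δ S (C.tsubst (CTy.one t)) (τ.subst (CTy.one t)) := by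
  have := h.tsubst ht.one
  rwa [map_shift_subst_one, LCtx.shift_tsubst_one] at this

/-! ### Typing under substitution of local expressions. -/

/-- `σ` replaces the local variables of `S` by local expressions that are well-typed in `S'`. -/
def LocalSubst (Γ : List Kind) (S S' : LCtx 𝕃) (σ : ℕ → 𝕃.Expr) : Prop :=
  ∀ x ρ t, S[x]? = some (ρ, t) → 𝕃.Typed (localKinds Γ) (S'.proj ρ) (σ x) t

theorem LocalSubst.shift {Γ : List Kind} {Δ : List (CTy 𝕃)} {S S' : LCtx 𝕃} {σ : ℕ → 𝕃.Expr}
    (κ : Kind) (hσ : LocalSubst Γ S S' σ) (hS' : WF Γ Δ S') :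
    LocalSubst (κ :: Γ) S.shift S'.shift fun n => shiftTyE (σ n) := by
  intro x ρ t hx
  rw [LCtx.shift, List.getElem?_map, Option.map_eq_some_iff] at hx
  obtain ⟨⟨ρ, t⟩, hy, h⟩ := hx
  cases h
  have hk : ∀ α ∈ localKinds Γ, 𝕃.Kinded (localKinds (κ :: Γ)) (𝕃.tvar (α + 1)) :=
    fun α hα => 𝕃.kinded_tvar _ _ hα
  refine LocalLang.typed_mono (𝕃.typed_instTy _ _ _ _ _ _ (hσ x ρ t hy) hk) ?_
    ((hS'.shift κ).kinded_proj _)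
  intro y s hy
  change S'.shift.proj ρ.shift y = some s
  rw [LCtx.shift_eq_tsubst, CTy.shift_eq_subst]
  exact LCtx.proj_tsubst (fun n => .var (n + 1)) hy

theorem LocalSubst.weaken {Γ : List Kind} {Δ : List (CTy 𝕃)} {S : LCtx 𝕃} {ρ : CTy 𝕃} {t : 𝕃.Ty}
    (h : WF Γ Δ ((ρ, t) :: S)) : LocalSubst Γ S ((ρ, t) :: S) fun n => 𝕃.var (n + 1) :=
  fun _ ρ' _ hx => 𝕃.typed_var _ _ _ _ (h.kinded_proj ρ')
    (LCtx.proj_eq_some.2 ⟨ρ', hx, .refl _⟩)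

theorem LocalSubst.up {Γ : List Kind} {Δ : List (CTy 𝕃)} {S S' : LCtx 𝕃} {σ : ℕ → 𝕃.Expr}
    {ρ : CTy 𝕃} {t : 𝕃.Ty} (hσ : LocalSubst Γ S S' σ) (hS' : WF Γ Δ ((ρ, t) :: S')) :
    LocalSubst Γ ((ρ, t) :: S) ((ρ, t) :: S') (upE σ) := by
  intro x ρ' t' hx
  cases x with
  | zero => exact 𝕃.typed_var _ _ _ _ (hS'.kinded_proj ρ') (LCtx.proj_eq_some.2 ⟨ρ', hx, .refl _⟩)
  | succ x =>
    refine 𝕃.typed_subst _ _ _ _ _ _ (hσ x ρ' t' hx) (hS'.kinded_proj ρ') fun y s hy => ?_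
    obtain ⟨ρ'', hy, hs⟩ := LCtx.proj_eq_some.1 hy
    exact 𝕃.typed_var _ _ _ _ (hS'.kinded_proj ρ') (LCtx.proj_eq_some.2 ⟨ρ'', hy, hs⟩)

theorem LocalSubst.one {Γ : List Kind} {Δ : List (CTy 𝕃)} {S : LCtx 𝕃} {e : 𝕃.Expr}
    {ρ : CTy 𝕃} {t : 𝕃.Ty} (hS : WF Γ Δ S) (he : 𝕃.Typed (localKinds Γ) (S.proj ρ) e t) :
    LocalSubst Γ ((ρ, t) :: S) S (oneE e) := by
  intro x ρ' t' hx
  cases x with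
  | zero => cases hx; exact he
  | succ x => exact 𝕃.typed_var _ _ _ _ (hS.kinded_proj ρ') (LCtx.proj_eq_some.2 ⟨ρ', hx, .refl _⟩)

theorem Typed.esubst {Γ : List Kind} {Δ : List (CTy 𝕃)} {S : LCtx 𝕃} {C : Chor 𝕃} {τ : CTy 𝕃}
    (h : Typed Γ Δ S C τ) : ∀ {S' : LCtx 𝕃} {σ : ℕ → 𝕃.Expr}, WF Γ Δ S' →
      LocalSubst Γ S S' σ → Typed Γ Δ S' (C.esubst σ) τ := by
  induction h with
  | var _ hn => intro S' σ hS' hσ; exact .var hS' hn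
  | comp h hρ he =>
    intro S' σ hS' hσ
    refine .comp hS' hρ (𝕃.typed_subst _ _ _ _ _ _ he (hS'.kinded_proj _) fun x s hx => ?_)
    obtain ⟨ρ', hx, hs⟩ := LCtx.proj_eq_some.1 hx
    -- The replacement is typed for the set `ρ'` where the variable is bound; the set using it is
    -- smaller and sees at least as much.
    exact LocalLang.typed_mono (hσ x ρ' s hx) (LCtx.proj_mono hs) (hS'.kinded_proj _)
  | fn h ih =>
    intro S' σ hS' hσ
    exact .fn (ih (.add (.add hS' h.wf.tail.head) h.wf.head) hσ)
  | app _ _ ih₁ ih₂ => intro S' σ hS' hσ; exact .app (ih₁ hS' hσ) (ih₂ hS' hσ)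
  | tabs _ ih => intro S' σ hS' hσ; exact .tabs (ih (hS'.shift _) (hσ.shift _ hS'))
  | tapp _ ht ih => intro S' σ hS' hσ; exact .tapp (ih hS' hσ) ht
  | fold hk _ ih => intro S' σ hS' hσ; exact .fold hk (ih hS' hσ)
  | unfold _ ih => intro S' σ hS' hσ; exact .unfold (ih hS' hσ)
  | pair _ _ ih₁ ih₂ => intro S' σ hS' hσ; exact .pair (ih₁ hS' hσ) (ih₂ hS' hσ)
  | fst _ ih => intro S' σ hS' hσ; exact .fst (ih hS' hσ)
  | snd _ ih => intro S' σ hS' hσ; exact .snd (ih hS' hσ)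
  | inl _ hk ih => intro S' σ hS' hσ; exact .inl (ih hS' hσ) hk
  | inr _ hk ih => intro S' σ hS' hσ; exact .inr (ih hS' hσ) hk
  | caseOf _ h₁ h₂ ih ih₁ ih₂ =>
    intro S' σ hS' hσ
    exact .caseOf (ih hS' hσ) (ih₁ (.add hS' h₁.wf.head) hσ) (ih₂ (.add hS' h₂.wf.head) hσ)
  | letE _ hs h₂ ih₁ ih₂ =>
    intro S' σ hS' hσ
    have hw := hS'.addLocal h₂.wf.localHead.1 h₂.wf.localHead.2
    exact .letE (ih₁ hS' hσ) hs (ih₂ hw (hσ.up hw))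
  | letLoc _ hs hA hk _ ih₁ ih₂ =>
    intro S' σ hS' hσ
    exact .letLoc (ih₁ hS' hσ) hs hA hk (ih₂ (hS'.shift _) (hσ.shift _ hS'))
  | letLocSet _ hs hA hk _ ih₁ ih₂ =>
    intro S' σ hS' hσ
    exact .letLocSet (ih₁ hS' hσ) hs hA hk (ih₂ (hS'.shift _) (hσ.shift _ hS'))
  | letLocalTy _ hs hk _ ih₁ ih₂ =>
    intro S' σ hS' hσ
    exact .letLocalTy (ih₁ hS' hσ) hs hk (ih₂ (hS'.shift _) (hσ.shift _ hS'))
  | send _ hn hk ih => intro S' σ hS' hσ; exact .send (ih hS' hσ) hn hk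
  | sync hl hk _ ih => intro S' σ hS' hσ; exact .sync hl hk (ih hS' hσ)
  | ite _ hs _ _ ih ih₁ ih₂ =>
    intro S' σ hS' hσ
    exact .ite (ih hS' hσ) hs (ih₁ hS' hσ) (ih₂ hS' hσ)

theorem Typed.shiftE {Γ : List Kind} {Δ : List (CTy 𝕃)} {S : LCtx 𝕃} {C : Chor 𝕃} {τ ρ : CTy 𝕃}
    {t : 𝕃.Ty} (h : Typed Γ Δ S C τ) (hw : WF Γ Δ ((ρ, t) :: S)) :
    Typed Γ Δ ((ρ, t) :: S) C.shiftE τ :=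
  h.esubst hw (LocalSubst.weaken hw)

/-! ### Typing under renaming and substitution of choreographic variables. -/

theorem getElem?_upRen {α : Type*} {Δ Δ' : List α} {ξ : ℕ → ℕ} (a : α)
    (hξ : ∀ n τ, Δ[n]? = some τ → Δ'[ξ n]? = some τ) :
    ∀ n τ, (a :: Δ)[n]? = some τ → (a :: Δ')[upRen ξ n]? = some τ := by
  intro n τ h
  cases n with
  | zero => exact h
  | succ n => exact hξ n τ h

theorem getElem?_map_of_forall {α β : Type*} {Δ Δ' : List α} {ξ : ℕ → ℕ} (f : α → β)
    (hξ : ∀ n τ, Δ[n]? = some τ → Δ'[ξ n]? = some τ) :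
    ∀ n τ, (Δ.map f)[n]? = some τ → (Δ'.map f)[ξ n]? = some τ := by
  intro n τ h
  rw [List.getElem?_map, Option.map_eq_some_iff] at h ⊢
  obtain ⟨a, h, rfl⟩ := h
  exact ⟨a, hξ n a h, rfl⟩

theorem Typed.rename {Γ : List Kind} {Δ : List (CTy 𝕃)} {S : LCtx 𝕃} {C : Chor 𝕃} {τ : CTy 𝕃}
    (h : Typed Γ Δ S C τ) : ∀ {Δ' : List (CTy 𝕃)} {ξ : ℕ → ℕ}, WF Γ Δ' S →
      (∀ n τ, Δ[n]? = some τ → Δ'[ξ n]? = some τ) → Typed Γ Δ' S (C.rename ξ) τ := by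
  induction h with
  | var _ hn => intro Δ' ξ hw hξ; exact .var hw (hξ _ _ hn)
  | comp _ hρ he => intro Δ' ξ hw hξ; exact .comp hw hρ he
  | fn h ih =>
    intro Δ' ξ hw hξ
    exact .fn (ih (.add (.add hw h.wf.tail.head) h.wf.head)
      (getElem?_upRen _ (getElem?_upRen _ hξ)))
  | app _ _ ih₁ ih₂ => intro Δ' ξ hw hξ; exact .app (ih₁ hw hξ) (ih₂ hw hξ)
  | tabs _ ih =>
    intro Δ' ξ hw hξ; exact .tabs (ih (hw.shift _) (getElem?_map_of_forall _ hξ))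
  | tapp _ ht ih => intro Δ' ξ hw hξ; exact .tapp (ih hw hξ) ht
  | fold hk _ ih => intro Δ' ξ hw hξ; exact .fold hk (ih hw hξ)
  | unfold _ ih => intro Δ' ξ hw hξ; exact .unfold (ih hw hξ)
  | pair _ _ ih₁ ih₂ => intro Δ' ξ hw hξ; exact .pair (ih₁ hw hξ) (ih₂ hw hξ)
  | fst _ ih => intro Δ' ξ hw hξ; exact .fst (ih hw hξ)
  | snd _ ih => intro Δ' ξ hw hξ; exact .snd (ih hw hξ)
  | inl _ hk ih => intro Δ' ξ hw hξ; exact .inl (ih hw hξ) hk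
  | inr _ hk ih => intro Δ' ξ hw hξ; exact .inr (ih hw hξ) hk
  | caseOf _ h₁ h₂ ih ih₁ ih₂ =>
    intro Δ' ξ hw hξ
    exact .caseOf (ih hw hξ) (ih₁ (.add hw h₁.wf.head) (getElem?_upRen _ hξ))
      (ih₂ (.add hw h₂.wf.head) (getElem?_upRen _ hξ))
  | letE _ hs h₂ ih₁ ih₂ =>
    intro Δ' ξ hw hξ
    exact .letE (ih₁ hw hξ) hs (ih₂ (.addLocal hw h₂.wf.localHead.1 h₂.wf.localHead.2) hξ)
  | letLoc _ hs hA hk _ ih₁ ih₂ =>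
    intro Δ' ξ hw hξ
    exact .letLoc (ih₁ hw hξ) hs hA hk (ih₂ (hw.shift _) (getElem?_map_of_forall _ hξ))
  | letLocSet _ hs hA hk _ ih₁ ih₂ =>
    intro Δ' ξ hw hξ
    exact .letLocSet (ih₁ hw hξ) hs hA hk (ih₂ (hw.shift _) (getElem?_map_of_forall _ hξ))
  | letLocalTy _ hs hk _ ih₁ ih₂ =>
    intro Δ' ξ hw hξ
    exact .letLocalTy (ih₁ hw hξ) hs hk (ih₂ (hw.shift _) (getElem?_map_of_forall _ hξ))
  | send _ hn hk ih => intro Δ' ξ hw hξ; exact .send (ih hw hξ) hn hk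
  | sync hl hk _ ih => intro Δ' ξ hw hξ; exact .sync hl hk (ih hw hξ)
  | ite _ hs _ _ ih ih₁ ih₂ =>
    intro Δ' ξ hw hξ
    exact .ite (ih hw hξ) hs (ih₁ hw hξ) (ih₂ hw hξ)

/-- `σ` replaces the variables of `Δ` by choreographies that are well-typed in `Δ'`. -/
def ChorSubst (Γ : List Kind) (S : LCtx 𝕃) (Δ Δ' : List (CTy 𝕃)) (σ : ℕ → Chor 𝕃) : Prop :=
  ∀ n τ, Δ[n]? = some τ → Typed Γ Δ' S (σ n) τ

theorem ChorSubst.shiftT {Γ : List Kind} {S : LCtx 𝕃} {Δ Δ' : List (CTy 𝕃)} {σ : ℕ → Chor 𝕃}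
    (κ : Kind) (hσ : ChorSubst Γ S Δ Δ' σ) :
    ChorSubst (κ :: Γ) S.shift (Δ.map CTy.shift) (Δ'.map CTy.shift) fun n => (σ n).shiftT := by
  intro n τ h
  rw [List.getElem?_map, Option.map_eq_some_iff] at h
  obtain ⟨τ, h, rfl⟩ := h
  exact (hσ n τ h).shiftT κ

theorem ChorSubst.up {Γ : List Kind} {S : LCtx 𝕃} {Δ Δ' : List (CTy 𝕃)} {σ : ℕ → Chor 𝕃}
    {τ : CTy 𝕃} (hσ : ChorSubst Γ S Δ Δ' σ) (hw : WF Γ (τ :: Δ') S) :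
    ChorSubst Γ S (τ :: Δ) (τ :: Δ') (Chor.up σ) := by
  intro n τ' h
  cases n with
  | zero => exact .var hw h
  | succ n => exact (hσ n τ' h).rename hw fun _ _ h => h

theorem ChorSubst.one {Γ : List Kind} {S : LCtx 𝕃} {Δ : List (CTy 𝕃)} {C : Chor 𝕃} {τ : CTy 𝕃}
    (h : Typed Γ Δ S C τ) : ChorSubst Γ S (τ :: Δ) Δ (Chor.one C) := by
  intro n τ' hn
  cases n with
  | zero => cases hn; exact h
  | succ n => exact .var h.wf hn

theorem ChorSubst.two {Γ : List Kind} {S : LCtx 𝕃} {Δ : List (CTy 𝕃)} {C₀ C₁ : Chor 𝕃}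
    {τ₀ τ₁ : CTy 𝕃} (h₀ : Typed Γ Δ S C₀ τ₀) (h₁ : Typed Γ Δ S C₁ τ₁) :
    ChorSubst Γ S (τ₀ :: τ₁ :: Δ) Δ (Chor.two C₀ C₁) := by
  intro n τ' hn
  match n with
  | 0 => cases hn; exact h₀
  | 1 => cases hn; exact h₁
  | n + 2 => exact .var h₀.wf hn

/-- Each sort of binder crossed weakens the substituted choreographies in its own way:
`Typed.rename` for choreographic binders, `Typed.shiftE` for local ones, `Typed.shiftT` for type
binders. -/
theorem Typed.subst {Γ : List Kind} {Δ : List (CTy 𝕃)} {S : LCtx 𝕃} {C : Chor 𝕃} {τ : CTy 𝕃}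
    (h : Typed Γ Δ S C τ) : ∀ {Δ' : List (CTy 𝕃)} {σ : ℕ → Chor 𝕃}, WF Γ Δ' S →
      ChorSubst Γ S Δ Δ' σ → Typed Γ Δ' S (C.subst σ) τ := by
  induction h with
  | var _ hn => intro Δ' σ hw hσ; exact hσ _ _ hn
  | comp _ hρ he => intro Δ' σ hw hσ; exact .comp hw hρ he
  | fn h ih =>
    intro Δ' σ hw hσ
    have h₁ := hw.add h.wf.tail.head
    have h₂ := h₁.add h.wf.head
    exact .fn (ih h₂ ((hσ.up h₁).up h₂))
  | app _ _ ih₁ ih₂ => intro Δ' σ hw hσ; exact .app (ih₁ hw hσ) (ih₂ hw hσ)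
  | tabs _ ih => intro Δ' σ hw hσ; exact .tabs (ih (hw.shift _) (hσ.shiftT _))
  | tapp _ ht ih => intro Δ' σ hw hσ; exact .tapp (ih hw hσ) ht
  | fold hk _ ih => intro Δ' σ hw hσ; exact .fold hk (ih hw hσ)
  | unfold _ ih => intro Δ' σ hw hσ; exact .unfold (ih hw hσ)
  | pair _ _ ih₁ ih₂ => intro Δ' σ hw hσ; exact .pair (ih₁ hw hσ) (ih₂ hw hσ)
  | fst _ ih => intro Δ' σ hw hσ; exact .fst (ih hw hσ)
  | snd _ ih => intro Δ' σ hw hσ; exact .snd (ih hw hσ)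
  | inl _ hk ih => intro Δ' σ hw hσ; exact .inl (ih hw hσ) hk
  | inr _ hk ih => intro Δ' σ hw hσ; exact .inr (ih hw hσ) hk
  | caseOf _ h₁ h₂ ih ih₁ ih₂ =>
    intro Δ' σ hw hσ
    have hw₁ := hw.add h₁.wf.head
    have hw₂ := hw.add h₂.wf.head
    exact .caseOf (ih hw hσ) (ih₁ hw₁ (hσ.up hw₁)) (ih₂ hw₂ (hσ.up hw₂))
  | letE _ hs h₂ ih₁ ih₂ =>
    intro Δ' σ hw hσ
    have hw₂ := hw.addLocal h₂.wf.localHead.1 h₂.wf.localHead.2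
    exact .letE (ih₁ hw hσ) hs (ih₂ hw₂ fun n τ h => (hσ n τ h).shiftE hw₂)
  | letLoc _ hs hA hk _ ih₁ ih₂ =>
    intro Δ' σ hw hσ
    exact .letLoc (ih₁ hw hσ) hs hA hk (ih₂ (hw.shift _) (hσ.shiftT _))
  | letLocSet _ hs hA hk _ ih₁ ih₂ =>
    intro Δ' σ hw hσ
    exact .letLocSet (ih₁ hw hσ) hs hA hk (ih₂ (hw.shift _) (hσ.shiftT _))
  | letLocalTy _ hs hk _ ih₁ ih₂ =>
    intro Δ' σ hw hσ
    exact .letLocalTy (ih₁ hw hσ) hs hk (ih₂ (hw.shift _) (hσ.shiftT _))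
  | send _ hn hk ih => intro Δ' σ hw hσ; exact .send (ih hw hσ) hn hk
  | sync hl hk _ ih => intro Δ' σ hw hσ; exact .sync hl hk (ih hw hσ)
  | ite _ hs _ _ ih ih₁ ih₂ =>
    intro Δ' σ hw hσ
    exact .ite (ih hw hσ) hs (ih₁ hw hσ) (ih₂ hw hσ)

/-! ### Blocked locations and the invariant for out-of-order steps. -/

theorem Redex.rloc_exitE (k : ℕ) (R : Redex 𝕃) : (R.exitE k).rloc = R.rloc := by
  unfold Redex.exitE
  induction R <;> simp_all [Redex.map, Redex.rloc]

/-- Blocked locations enter only through `poss`, which ignores variable names; hence the choice of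
`k` is immaterial. -/
theorem Redex.rloc_exitT (k : ℕ) (R : Redex 𝕃) : (R.exitT k).rloc = R.rloc := by
  have h (l : CTy 𝕃) : poss (.sng (l.rename (exitScope k))) = poss (.sng l) :=
    poss_rename _ (.sng l)
  unfold Redex.exitT
  induction R <;> simp_all [Redex.map, Redex.rloc, poss_rename]

theorem EvalCtx.rloc_redex (η : EvalCtx 𝕃) (R : Redex 𝕃) : (η.redex R).rloc = R.rloc := by
  cases η <;> rfl

/-- The redex `R` involves no location where a variable of `S` is bound. -/
def Avoids (R : Redex 𝕃) (S : LCtx 𝕃) : Prop :=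
  ∀ p ∈ S, Disjoint R.rloc (poss p.1)

theorem Avoids.of_rloc_eq {R R' : Redex 𝕃} {S : LCtx 𝕃} (h : Avoids R S) (hR : R.rloc = R'.rloc) :
    Avoids R' S := fun p hp => hR ▸ h p hp

theorem Avoids.cons {R : Redex 𝕃} {S : LCtx 𝕃} {ρ : CTy 𝕃} {t : 𝕃.Ty} (h : Avoids R S)
    (hρ : Disjoint R.rloc (poss ρ)) : Avoids R ((ρ, t) :: S) := by
  intro p hp
  rcases List.mem_cons.1 hp with rfl | hp
  · exact hρ
  · exact h p hp

theorem Avoids.shift {R : Redex 𝕃} {S : LCtx 𝕃} (h : Avoids R S) : Avoids R S.shift := by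
  intro p hp
  obtain ⟨q, hq, rfl⟩ := List.mem_map.1 hp
  have := h q hq
  rwa [← poss_rename Nat.succ] at this

/-- If a redex that involves a location of `ρ` avoids `S`, then no variable of `S` can be used by
all of `ρ`. -/
theorem Avoids.proj_eq_none {Γ : List Kind} {R : Redex 𝕃} {S : LCtx 𝕃} {l ρ : CTy 𝕃}
    (h : Avoids R S) (hl : Nec l ρ) (hρ : Kinded Γ ρ .locSet) (hR : poss (.sng l) ⊆ R.rloc) :
    S.proj ρ = fun _ => none := by
  funext x
  by_contra hx
  obtain ⟨t, ht⟩ := Option.ne_none_iff_exists'.1 hx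
  obtain ⟨ρ', hS, hs⟩ := LCtx.proj_eq_some.1 ht
  have hk := Kinded.of_nec hl hρ
  -- The contradiction is at `l`: it is blocked by `R`, and it lies in `ρ'` because `l ∈ ρ ⊆ ρ'`.
  exact Set.disjoint_left.1 (h _ (List.mem_of_getElem? hS)) (hR (Poss.of_nec hk (.sng l)))
    (Poss.of_nec hk (hl.mono hs))

/-! ### Preservation. -/

theorem Kinded.resolve {Γ : List Kind} {S : ℕ → Option 𝕃.Ty} {κ : Kind} {v : 𝕃.Expr} {t : CTy 𝕃}
    (hv : 𝕃.IsVal v) (hκ : κ = .lty → 𝕃.Typed (localKinds Γ) S v 𝕃.repTy)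
    (h : resolve 𝕃 κ v = some t) : Kinded Γ t κ := by
  cases κ with
  | chor => cases h
  | lty =>
    obtain ⟨t, ht, rfl⟩ := Option.map_eq_some_iff.1 h
    exact .lty (𝕃.rep_kinded _ _ _ _ hv (hκ rfl) ht)
  | loc =>
    obtain ⟨L, -, rfl⟩ := Option.map_eq_some_iff.1 h
    exact .loc L
  | locSet =>
    obtain ⟨A, -, rfl⟩ := Option.map_eq_some_iff.1 h
    exact .ofFinset Γ A

theorem Typed.letT_value {Γ : List Kind} {Δ : List (CTy 𝕃)} {S : LCtx 𝕃} {ρ ρ' t τ : CTy 𝕃}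
    {κ : Kind} {v : 𝕃.Expr} {C : Chor 𝕃} (h : Typed Γ Δ S (.letT ρ κ (.comp ρ' v) C) τ)
    (hv : 𝕃.IsVal v) (ht : resolve 𝕃 κ v = some t) :
    Typed Γ Δ S (C.tsubst (CTy.one t)) τ := by
  have key (h : Typed (κ :: Γ) (Δ.map CTy.shift) S.shift C τ.shift)
      (hκ : κ = .lty → 𝕃.Typed (localKinds Γ) (S.proj ρ') v 𝕃.repTy) :
      Typed Γ Δ S (C.tsubst (CTy.one t)) τ := by
    have := h.tsubst_one (Kinded.resolve hv hκ ht)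
    rwa [CTy.shift_subst_one] at this
  cases h with
  | letLoc _ _ _ _ h => exact key h nofun
  | letLocSet _ _ _ _ h => exact key h nofun
  | letLocalTy hc _ _ h => cases hc with | comp _ _ hc => exact key h fun _ => hc

/-- Emptiness of `S` is not inductive, as the body of a `let` is typed in a longer local context.
`Avoids R S` is: it holds trivially for empty `S`, and the side conditions of the out-of-order rules
maintain it. -/
theorem preservation (hpres : 𝕃.Preservation) {C C' : Chor 𝕃} {R : Redex 𝕃} (h : Step C R C') :
    ∀ {Γ : List Kind} {Δ : List (CTy 𝕃)} {S : LCtx 𝕃} {τ : CTy 𝕃},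
      𝕃.ValuesClosed ∨ Avoids R S → Typed Γ Δ S C τ → Typed Γ Δ S C' τ := by
  induction h with
  | ctx η _ ih =>
    intro Γ Δ S τ ha ht
    replace ih {τ} := @ih Γ Δ S τ (ha.imp_right fun ha => ha.of_rloc_eq (η.rloc_redex _))
    cases η with
    | appL => cases ht with | app h₁ h₂ => exact .app (ih h₁) h₂
    | appR => cases ht with | app h₁ h₂ => exact .app h₁ (ih h₂)
    | tapp => cases ht with | tapp h hk => exact .tapp (ih h) hk
    | fold => cases ht with | fold hk h => exact .fold hk (ih h)
    | unfold => cases ht with | unfold h => exact .unfold (ih h)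
    | pairL => cases ht with | pair h₁ h₂ => exact .pair (ih h₁) h₂
    | pairR => cases ht with | pair h₁ h₂ => exact .pair h₁ (ih h₂)
    | fst => cases ht with | fst h => exact .fst (ih h)
    | snd => cases ht with | snd h => exact .snd (ih h)
    | inl => cases ht with | inl h hk => exact .inl (ih h) hk
    | inr => cases ht with | inr h hk => exact .inr (ih h) hk
    | caseOf => cases ht with | caseOf h h₁ h₂ => exact .caseOf (ih h) h₁ h₂
    | letE => cases ht with | letE h hs h₂ => exact .letE (ih h) hs h₂
    | letT =>
      cases ht with
      | letLoc h hs hA hk h₂ => exact .letLoc (ih h) hs hA hk h₂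
      | letLocSet h hs hA hk h₂ => exact .letLocSet (ih h) hs hA hk h₂
      | letLocalTy h hs hk h₂ => exact .letLocalTy (ih h) hs hk h₂
    | send => cases ht with | send h hn hk => exact .send (ih h) hn hk
    | ite => cases ht with | ite h hs h₁ h₂ => exact .ite (ih h) hs h₁ h₂
  | comp he =>
    intro Γ Δ S τ _ ht
    cases ht with | comp hw hρ h => exact .comp hw hρ (hpres _ _ _ _ _ h he)
  | app =>
    intro Γ Δ S τ _ ht
    cases ht with
    | app h₁ h₂ => cases h₁ with | fn h => exact h.subst h₂.wf (.two h₂ (.fn h))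
  | tapp =>
    intro Γ Δ S τ _ ht
    cases ht with | tapp h hk => cases h with | tabs h => exact h.tsubst_one hk
  | unfoldFold =>
    intro Γ Δ S τ _ ht
    cases ht with | unfold h => cases h with | fold _ h => exact h
  | fstPair =>
    intro Γ Δ S τ _ ht
    cases ht with | fst h => cases h with | pair h _ => exact h
  | sndPair =>
    intro Γ Δ S τ _ ht
    cases ht with | snd h => cases h with | pair _ h => exact h
  | caseInl =>
    intro Γ Δ S τ _ ht
    cases ht with
    | caseOf h h₁ _ => cases h with | inl h _ => exact h₁.subst h.wf (.one h)
  | caseInr =>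
    intro Γ Δ S τ _ ht
    cases ht with
    | caseOf h _ h₂ => cases h with | inr h _ => exact h₂.subst h.wf (.one h)
  | letEV hv =>
    intro Γ Δ S τ _ ht
    cases ht with
    | letE h hs h₂ =>
      cases h with
      | comp hw _ h =>
        exact h₂.esubst hw (.one hw
          (LocalLang.typed_mono h (LCtx.proj_mono hs) (hw.kinded_proj _)))
  | letEI k _ hd ih =>
    intro Γ Δ S τ ha ht
    rw [Redex.rloc_exitE] at hd
    cases ht with
    | letE h hs h₂ =>
      -- The `poss ρ` half of the side condition is exactly what the new declaration at `ρ` demands.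
      exact .letE h hs (ih (ha.imp_right fun ha =>
        (ha.of_rloc_eq (Redex.rloc_exitE k _)).cons (hd.mono_right Set.subset_union_left)) h₂)
  | letTV hv hr => intro Γ Δ S τ _ ht; exact ht.letT_value hv hr
  | letTI k _ _ ih =>
    intro Γ Δ S τ ha ht
    have ha := ha.imp_right fun ha => (ha.of_rloc_eq (Redex.rloc_exitT k _)).shift
    cases ht with
    | letLoc h hs hA hk h₂ => exact .letLoc h hs hA hk (ih ha h₂)
    | letLocSet h hs hA hk h₂ => exact .letLocSet h hs hA hk (ih ha h₂)
    | letLocalTy h hs hk h₂ => exact .letLocalTy h hs hk (ih ha h₂)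
  | sendV hv =>
    intro Γ Δ S τ ha ht
    cases ht with
    | send h hn hk =>
      cases h with
      | comp hw hρ h =>
        -- The enlarged set may see fewer declarations, so the value is first typed with none at all
        -- and then weakened.
        refine .comp hw (.union hρ hk) (LocalLang.typed_mono (S := fun _ => none) ?_ nofun
          (hw.kinded_proj _))
        rcases ha with hc | ha
        · exact hc _ _ _ _ hv h
        -- The sender belongs to the set holding the value and is blocked by the send.
        · rwa [ha.proj_eq_none hn hρ Set.subset_union_left] at h
  | sync =>
    intro Γ Δ S τ _ ht
    cases ht with | sync _ _ h => exact h
  | syncI _ _ ih =>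
    intro Γ Δ S τ ha ht
    cases ht with | sync hl hk h => exact .sync hl hk (ih ha h)
  | ifT =>
    intro Γ Δ S τ _ ht
    cases ht with | ite _ _ h _ => exact h
  | ifF =>
    intro Γ Δ S τ _ ht
    cases ht with | ite _ _ _ h => exact h
  | ifI _ _ _ ih₁ ih₂ =>
    intro Γ Δ S τ ha ht
    cases ht with | ite h hs h₁ h₂ => exact .ite h hs (ih₁ ha h₁) (ih₂ ha h₂)
  | appI _ _ ih =>
    intro Γ Δ S τ ha ht
    cases ht with | app h₁ h₂ => exact .app h₁ (ih ha h₂)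
  | pairI _ _ ih =>
    intro Γ Δ S τ ha ht
    cases ht with | pair h₁ h₂ => exact .pair h₁ (ih ha h₂)

/-! ### Progress. -/

theorem Typed.local_value {C : Chor 𝕃} {t : 𝕃.Ty} {ρ : CTy 𝕃}
    (h : Typed [] [] [] C (.located t ρ)) (hv : C.IsVal) :
    ∃ v, C = .comp ρ v ∧ 𝕃.IsVal v ∧ 𝕃.Typed ∅ (fun _ => none) v t := by
  cases hv with
  | comp hv =>
    cases h with
    | comp _ _ h =>
      have h₀ : localKinds [] = ∅ := by ext; simp [localKinds]
      rw [h₀] at h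
      exact ⟨_, rfl, hv, h⟩
  | _ => cases h

/-- A choreography is a value or steps. -/
def Progresses (C : Chor 𝕃) : Prop :=
  C.IsVal ∨ ∃ R C', Step C R C'

theorem Progresses.fill {C : Chor 𝕃} (η : EvalCtx 𝕃) (h : Progresses C)
    (hv : C.IsVal → Progresses (η.fill C)) : Progresses (η.fill C) := by
  rcases h with h | ⟨R, C', h⟩
  · exact hv h
  · exact .inr ⟨_, _, .ctx η h⟩

/-- The contexts stay variables, constrained by equations, so that induction on typing applies.
Premises under binders are never consulted: abstractions are values, and the other constructs step
by their principal subterms. -/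
theorem progress (hprog : 𝕃.Progress) {Γ : List Kind} {Δ : List (CTy 𝕃)} {S : LCtx 𝕃} {C : Chor 𝕃}
    {τ : CTy 𝕃} (h : Typed Γ Δ S C τ) : Γ = [] → Δ = [] → S = [] → Progresses C := by
  induction h with
  | var _ hn => rintro - rfl -; simp at hn
  | comp _ _ h =>
    rintro rfl - rfl
    have h₀ : localKinds [] = ∅ := by ext; simp [localKinds]
    rw [h₀] at h
    rcases hprog _ _ h with hv | ⟨e', h⟩
    · exact .inl (.comp hv)
    · exact .inr ⟨_, _, .comp h⟩
  | fn => rintro - - -; exact .inl .fn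
  | app h₁ h₂ ih₁ ih₂ =>
    rintro rfl rfl rfl
    refine (ih₁ rfl rfl rfl).fill (.appL _) fun hv₁ => ?_
    refine (ih₂ rfl rfl rfl).fill (.appR _ hv₁) fun hv₂ => ?_
    cases hv₁ with
    | fn => exact .inr ⟨_, _, .app hv₂⟩
    -- Canonical forms: no other value has an arrow type.
    | _ => cases h₁
  | tabs => rintro - - -; exact .inl .tabs
  | tapp h _ ih =>
    rintro rfl rfl rfl
    refine (ih rfl rfl rfl).fill (.tapp _) fun hv => ?_
    cases hv with
    | tabs => exact .inr ⟨_, _, .tapp⟩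
    | _ => cases h
  | fold _ _ ih =>
    rintro rfl rfl rfl
    exact (ih rfl rfl rfl).fill .fold fun hv => .inl hv.fold
  | unfold h ih =>
    rintro rfl rfl rfl
    refine (ih rfl rfl rfl).fill .unfold fun hv => ?_
    cases hv with
    | fold hv => exact .inr ⟨_, _, .unfoldFold hv⟩
    | _ => cases h
  | pair _ _ ih₁ ih₂ =>
    rintro rfl rfl rfl
    exact (ih₁ rfl rfl rfl).fill (.pairL _) fun hv₁ =>
      (ih₂ rfl rfl rfl).fill (.pairR _ hv₁) fun hv₂ => .inl (hv₁.pair hv₂)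
  | fst h ih =>
    rintro rfl rfl rfl
    refine (ih rfl rfl rfl).fill .fst fun hv => ?_
    cases hv with
    | pair hv₁ hv₂ => exact .inr ⟨_, _, .fstPair hv₁ hv₂⟩
    | _ => cases h
  | snd h ih =>
    rintro rfl rfl rfl
    refine (ih rfl rfl rfl).fill .snd fun hv => ?_
    cases hv with
    | pair hv₁ hv₂ => exact .inr ⟨_, _, .sndPair hv₁ hv₂⟩
    | _ => cases h
  | inl _ _ ih =>
    rintro rfl rfl rfl
    exact (ih rfl rfl rfl).fill .inl fun hv => .inl hv.inl
  | inr _ _ ih =>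
    rintro rfl rfl rfl
    exact (ih rfl rfl rfl).fill .inr fun hv => .inl hv.inr
  | caseOf h _ _ ih =>
    rintro rfl rfl rfl
    refine (ih rfl rfl rfl).fill (.caseOf _ _) fun hv => ?_
    cases hv with
    | inl hv => exact .inr ⟨_, _, .caseInl hv⟩
    | inr hv => exact .inr ⟨_, _, .caseInr hv⟩
    | _ => cases h
  | letE h _ _ ih =>
    rintro rfl rfl rfl
    refine (ih rfl rfl rfl).fill (.letE _ _ _) fun hv => ?_
    obtain ⟨v, rfl, hv, -⟩ := h.local_value hv
    exact .inr ⟨_, _, .letEV hv⟩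
  | letLoc h _ _ _ _ ih =>
    rintro rfl rfl rfl
    refine (ih rfl rfl rfl).fill (.letT _ _ _) fun hv => ?_
    obtain ⟨v, rfl, hv, ht⟩ := h.local_value hv
    obtain ⟨L, -, hL⟩ := 𝕃.val_loc v _ hv ht
    exact .inr ⟨_, _, .letTV hv (congrArg (Option.map CTy.loc) hL)⟩
  | letLocSet h _ _ _ _ ih =>
    rintro rfl rfl rfl
    refine (ih rfl rfl rfl).fill (.letT _ _ _) fun hv => ?_
    obtain ⟨v, rfl, hv, ht⟩ := h.local_value hv
    obtain ⟨B, -, hB⟩ := 𝕃.val_locSet v _ hv ht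
    exact .inr ⟨_, _, .letTV hv (congrArg (Option.map CTy.ofFinset) hB)⟩
  | letLocalTy h _ _ _ ih =>
    rintro rfl rfl rfl
    refine (ih rfl rfl rfl).fill (.letT _ _ _) fun hv => ?_
    obtain ⟨v, rfl, hv, ht⟩ := h.local_value hv
    obtain ⟨t, ht⟩ := 𝕃.val_rep v hv ht
    exact .inr ⟨_, _, .letTV hv (congrArg (Option.map CTy.lty) ht)⟩
  | send h _ _ ih =>
    rintro rfl rfl rfl
    refine (ih rfl rfl rfl).fill (.send _ _) fun hv => ?_
    obtain ⟨v, rfl, hv, -⟩ := h.local_value hv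
    exact .inr ⟨_, _, .sendV hv⟩
  -- A selection can always fire, whatever its continuation.
  | sync => rintro - - -; exact .inr ⟨_, _, .sync⟩
  | ite h _ _ _ ih =>
    rintro rfl rfl rfl
    refine (ih rfl rfl rfl).fill (.ite _ _ _) fun hv => ?_
    obtain ⟨v, rfl, hv, ht⟩ := h.local_value hv
    obtain ⟨_ | _, hb⟩ := 𝕃.val_bool v hv ht
    · exact .inr ⟨_, _, .ifF hv hb⟩
    · exact .inr ⟨_, _, .ifT hv hb⟩

end LambdaQC

open LambdaQC in
/-- Type soundness: preservation, in contexts without local variables and, if local values are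
closed, in all contexts; and progress. -/
theorem mainTheorem4 {Loc : Type u} (𝕃 : LocalLang.{u, v, w} Loc)
    (hprog : 𝕃.Progress) (hpres : 𝕃.Preservation) :
    (∀ (Γ : List Kind) (Δ : List (CTy 𝕃)) (S : LCtx 𝕃) (C C' : Chor 𝕃) (τ : CTy 𝕃) (R : Redex 𝕃),
      (S = [] ∨ 𝕃.ValuesClosed) → Typed Γ Δ S C τ → Step C R C' → Typed Γ Δ S C' τ) ∧
    (∀ (C : Chor 𝕃) (τ : CTy 𝕃), Typed [] [] [] C τ → C.IsVal ∨ ∃ R C', Step C R C') := by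
  refine ⟨fun Γ Δ S C C' τ R hS ht h => preservation hpres h ?_ ht,
    fun C τ h => progress hprog h rfl rfl rfl⟩
  rcases hS with rfl | hc
  -- An empty local context is avoided by every redex.
  · exact .inr nofun
  · exact .inl hc
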